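/- Let $\mathcal S'_+$ be the space of (complex) tempered distributions on $\mathbb R$ supported in $[0,\infty)$, and let $\mathcal E'(\mathbb R)$ be the space of compactly supported distributions on $\mathbb R$, i.e. the dual of $C^\infty(\mathbb R)$. For $\gamma\in\mathbb R$ and $y\in\mathcal S'_+$ put $D^\gamma y=f_{-\gamma}*y$, where $f_\alpha(x)=H(x)x^{\alpha-1}/\Gamma(\alpha)$ for $\alpha>0$ ($H$ the Heaviside function) and $f_\alpha=\frac{d^N}{dx^N}f_{\alpha+N}$ for $\alpha\le 0$, $\alpha+N>0$, $N\in\mathbb N$. The Laplace transform of $y\in\mathcal S'_+$ is $\hat y(s)=\mathcal L y(s)=\langle y(t),\chi(t)e^{-st}\rangle$, $\Re s>0$, where $\chi\in C^\infty(\mathbb R)$ equals $1$ on $(-a,\infty)$ and $0$ on $(-\infty,-2a)$ for some $a>0$ (the value does not depend on $\chi$). For $\phi\in\mathcal E'(\mathbb R)$ and $y\in\mathcal S'_+$ the distributed order fractional derivative $\int_{\mathrm{supp}\,\phi}\phi(\gamma)D^\gamma y\,d\gamma$ is the element of $\mathcal S'_+$ defined by $$\Big\langle \int_{\mathrm{supp}\,\phi}\phi(\gamma)D^\gamma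 y\,d\gamma,\ \psi\Big\rangle=\big\langle\phi(\gamma),\langle D^\gamma y,\psi\rangle\big\rangle,\qquad \psi\in\mathcal S(\mathbb R),$$ where $\gamma\mapsto\langle D^\gamma y,\psi\rangle$ is smooth. Let $\phi\in\mathcal E'(\mathbb R)$. Then the distributed order fractional derivative is well defined for every $y\in\mathcal S'_+$, and: a) the mapping $y\mapsto\int_{\mathrm{supp}\,\phi}\phi(\gamma)D^\gamma y\,d\gamma$ is linear and continuous from $\mathcal S'_+$ to $\mathcal S'_+$, both for the weak-* topology (pointwise convergence on $\mathcal S(\mathbb R)$) and for the strong topology (uniform convergence on bounded subsets of $\mathcal S(\mathbb R)$) on both sides; b) for every $y\in\mathcal S'_+$, $$\mathcal L\Big(\int_{\mathrm{supp}\,\phi}\phi(\gamma)D^\gamma y\,d\gamma\Big)(s)=\hat y(s)\,\langle\phi(\gamma),s^\gamma\rangle,\qquad \Re s>0,$$ with the principal branch of $s^\gamma$; c) if $\phi$ is (the distribution given by) a function that is continuous on $[c,d]$ and vanishes outside $[c,d]$, then for every $y\in\mathcal S'_+$ $$\mathcal L\Big(\int_c^d\phi(\gamma)D^\gamma y\,d\gamma\Big)(s)=\hat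 y(s)\int_c^d\phi(\gamma)s^\gamma\,d\gamma,\qquad \Re s>0.$$ -/

import Mathlib

open MeasureTheory Set
open scoped SchwartzMap ContDiff Topology

namespace DistOrder

/-- The smooth cutoff function on the line: `0` on `(-∞, -2]` and `1` on `[-1, ∞)`. -/
noncomputable def cutoff (t : ℝ) : ℂ := (Real.smoothTransition (t + 2) : ℂ)

theorem cutoff_of_le {t : ℝ} (h : t ≤ -2) : cutoff t = 0 := by
  simp [cutoff, Real.smoothTransition.zero_of_nonpos (show t + 2 ≤ 0 by linarith)]

theorem cutoff_of_ge {t : ℝ} (h : -1 ≤ t) : cutoff t = 1 := by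
  simp [cutoff, Real.smoothTransition.one_of_one_le (show 1 ≤ t + 2 by linarith)]

theorem contDiff_cutoff : ContDiff ℝ ∞ cutoff := by
  unfold cutoff
  exact Complex.ofRealCLM.contDiff.comp
    (Real.smoothTransition.contDiff.comp (contDiff_id.add contDiff_const))

theorem cutoff_deriv_of_lt (n : ℕ) {t : ℝ} (h : t < -2) : iteratedFDeriv ℝ n cutoff t = 0 := by
  have : cutoff =ᶠ[𝓝 t] fun _ => (0 : ℂ) := by
    filter_upwards [Iio_mem_nhds h] with u hu using cutoff_of_le (le_of_lt hu)
  rw [(this.iteratedFDeriv ℝ n).eq_of_nhds]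
  simp

theorem cutoff_deriv_bound (n : ℕ) : ∃ C : ℝ, 0 ≤ C ∧ ∀ t, ‖iteratedFDeriv ℝ n cutoff t‖ ≤ C := by
  have hc : Continuous fun t => ‖iteratedFDeriv ℝ n cutoff t‖ :=
    (contDiff_cutoff.continuous_iteratedFDeriv (by exact_mod_cast le_top)).norm
  obtain ⟨C, hC⟩ := (isCompact_Icc (a := (-2 : ℝ)) (b := -1)).bddAbove_image hc.continuousOn
  refine ⟨max C 1, by positivity, fun t => ?_⟩
  by_cases h1 : t < -2
  · simp [cutoff_deriv_of_lt n h1]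
  by_cases h2 : -1 < t
  · have : cutoff =ᶠ[𝓝 t] fun _ => (1 : ℂ) := by
      filter_upwards [Ioi_mem_nhds h2] with u hu using cutoff_of_ge (le_of_lt hu)
    rw [(this.iteratedFDeriv ℝ n).eq_of_nhds]
    refine le_trans ?_ (le_max_right _ _)
    rcases Nat.eq_zero_or_pos n with rfl | hn
    · simp
    · rw [iteratedFDeriv_const_of_ne hn.ne']
      simp
  · exact (hC ⟨t, ⟨not_lt.1 h1, not_lt.1 h2⟩, rfl⟩).trans (le_max_left _ _)

theorem hasTemperateGrowth_cutoff : cutoff.HasTemperateGrowth := by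
  refine ⟨contDiff_cutoff, fun n => ?_⟩
  obtain ⟨C, -, hC⟩ := cutoff_deriv_bound n
  exact ⟨0, C, fun x => by simpa using hC x⟩

/-- Leibniz estimate for products with the cutoff function. -/
theorem cutoff_mul_bound (n : ℕ) : ∃ K : ℝ, 0 ≤ K ∧ ∀ (G : ℝ → ℂ), ContDiff ℝ ∞ G →
    ∀ (w M x : ℝ), 0 ≤ w → 0 ≤ M →
    (-2 ≤ x → ∀ j ≤ n, w * ‖iteratedFDeriv ℝ j G x‖ ≤ M) →
    w * ‖iteratedFDeriv ℝ n (fun t => cutoff t * G t) x‖ ≤ K * M := by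
  choose C hC0 hC using cutoff_deriv_bound
  refine ⟨∑ i ∈ Finset.range (n + 1), (n.choose i : ℝ) * C i,
    Finset.sum_nonneg fun i _ => mul_nonneg (by positivity) (hC0 i), ?_⟩
  intro G hG w M x hw hM h
  have h0 := norm_iteratedFDeriv_mul_le (𝕜 := ℝ) contDiff_cutoff hG x (n := n)
    (by exact_mod_cast le_top)
  refine (mul_le_mul_of_nonneg_left h0 hw).trans ?_
  rw [Finset.mul_sum, Finset.sum_mul]
  refine Finset.sum_le_sum fun i hi => ?_
  by_cases hx : -2 ≤ x
  · have h1 := h hx (n - i) (Nat.sub_le _ _)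
    calc w * ((n.choose i : ℝ) * ‖iteratedFDeriv ℝ i cutoff x‖ * ‖iteratedFDeriv ℝ (n - i) G x‖)
        = (n.choose i : ℝ) * ‖iteratedFDeriv ℝ i cutoff x‖ *
          (w * ‖iteratedFDeriv ℝ (n - i) G x‖) := by ring
      _ ≤ (n.choose i : ℝ) * C i * M := by
        have := hC i x
        have := hC0 i
        gcongr
  · rw [cutoff_deriv_of_lt i (not_le.1 hx)]
    have := hC0 i
    simp only [norm_zero, mul_zero, zero_mul]
    positivity

/-- Translation `(τ_x ψ)(t) = ψ (x + t)` of a Schwartz function. -/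
noncomputable def shift (x : ℝ) : 𝓢(ℝ, ℂ) →L[ℂ] 𝓢(ℝ, ℂ) := SchwartzMap.compSubConstCLM ℂ (-x)

theorem shift_apply (x : ℝ) (ψ : 𝓢(ℝ, ℂ)) (t : ℝ) : shift x ψ t = ψ (x + t) := by
  simp [shift, add_comm]

theorem iteratedDeriv_shift (x : ℝ) (ψ : 𝓢(ℝ, ℂ)) (n : ℕ) (t : ℝ) :
    iteratedDeriv n (shift x ψ) t = iteratedDeriv n ψ (x + t) := by
  have : ⇑(shift x ψ) = fun t => ψ (x + t) := funext (shift_apply x ψ)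
  rw [this, iteratedDeriv_comp_const_add]

theorem iteratedDeriv_derivCLM (ψ : 𝓢(ℝ, ℂ)) (n : ℕ) (t : ℝ) :
    iteratedDeriv n (SchwartzMap.derivCLM ℂ ℂ ψ) t = iteratedDeriv (n + 1) ψ t := by
  rw [iteratedDeriv_succ']
  rfl

theorem iterate_derivCLM (ψ : 𝓢(ℝ, ℂ)) (n : ℕ) :
    ((SchwartzMap.derivCLM ℂ ℂ)^[n] ψ : ℝ → ℂ) = iteratedDeriv n ψ := by
  induction n with
  | zero => simp
  | succ n ih =>
    rw [Function.iterate_succ_apply', iteratedDeriv_succ, ← ih]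
    rfl

theorem clm_bound (L : 𝓢(ℝ, ℂ) →L[ℂ] ℂ) : ∃ (m : ℕ × ℕ) (C : ℝ), 0 ≤ C ∧ ∀ ψ : 𝓢(ℝ, ℂ),
    ‖L ψ‖ ≤ C * ∑ p ∈ Finset.Iic m, SchwartzMap.seminorm ℂ p.1 p.2 ψ := by
  obtain ⟨s, C, -, h⟩ := Seminorm.bound_of_continuous (schwartz_withSeminorms ℂ ℝ ℂ)
    ((normSeminorm ℂ ℂ).comp L.toLinearMap) (continuous_norm.comp L.continuous)
  refine ⟨(s.sup Prod.fst, s.sup Prod.snd), C, C.2, fun ψ => ?_⟩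
  have h1 : ‖L ψ‖ ≤ C * (s.sup (schwartzSeminormFamily ℂ ℝ ℂ)) ψ := h ψ
  refine h1.trans (mul_le_mul_of_nonneg_left ?_ C.2)
  refine (Seminorm.finset_sup_le_sum _ s ψ).trans ?_
  have e : (∑ i ∈ s, schwartzSeminormFamily ℂ ℝ ℂ i) ψ
      = ∑ i ∈ s, SchwartzMap.seminorm ℂ i.1 i.2 ψ := by
    change FunLike.coeAddMonoidHom _ _ _ (∑ i ∈ s, schwartzSeminormFamily ℂ ℝ ℂ i) ψ = _
    rw [map_sum, Finset.sum_apply]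
    rfl
  rw [e]
  refine Finset.sum_le_sum_of_subset_of_nonneg ?_ fun p _ _ => apply_nonneg _ _
  intro p hp
  exact Finset.mem_Iic.2 ⟨Finset.le_sup (f := Prod.fst) hp, Finset.le_sup (f := Prod.snd) hp⟩

theorem one_add_pow_le (ψ : 𝓢(ℝ, ℂ)) (k n : ℕ) (x : ℝ) :
    (1 + |x|) ^ k * ‖iteratedDeriv n ψ x‖ ≤
      2 ^ k * (Finset.Iic (k, n)).sup (schwartzSeminormFamily ℂ ℝ ℂ) ψ := by
  have := SchwartzMap.one_add_le_sup_seminorm_apply (𝕜 := ℂ) (m := (k, n)) le_rfl le_rfl ψ x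
  rw [norm_iteratedFDeriv_eq_norm_iteratedDeriv] at this
  exact this

/-- Second order Taylor estimate for translations in the Schwartz seminorms. -/
theorem shift_taylor (ψ : 𝓢(ℝ, ℂ)) (k n : ℕ) : ∃ C : ℝ, 0 ≤ C ∧ ∀ h : ℝ, |h| ≤ 1 →
    SchwartzMap.seminorm ℂ k n (shift h ψ - ψ - (h : ℂ) • SchwartzMap.derivCLM ℂ ℂ ψ)
      ≤ C * h ^ 2 := by
  set B := 2 ^ k * (Finset.Iic (k, n + 2)).sup (schwartzSeminormFamily ℂ ℝ ℂ) ψ with hB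
  have hB0 : 0 ≤ B := by positivity
  refine ⟨2 ^ k * B, by positivity, fun h hh => ?_⟩
  refine SchwartzMap.seminorm_le_bound' ℂ k n _ (by positivity) fun t => ?_
  have hd : ∀ m (u : ℝ), HasDerivAt (iteratedDeriv m ψ) (iteratedDeriv (m + 1) ψ u) u := by
    intro m u
    rw [iteratedDeriv_succ]
    exact ((ψ.smooth ⊤).differentiable_iteratedDeriv m
      (by exact_mod_cast ENat.natCast_lt_top m) u).hasDerivAt
  have e : iteratedDeriv n (shift h ψ - ψ - (h : ℂ) • SchwartzMap.derivCLM ℂ ℂ ψ : 𝓢(ℝ, ℂ)) t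
      = iteratedDeriv n ψ (h + t) - iteratedDeriv n ψ t - h * iteratedDeriv (n + 1) ψ t := by
    have cd : ∀ θ : 𝓢(ℝ, ℂ), ContDiffAt ℝ n θ t := fun θ => (θ.smooth n).contDiffAt
    have e1 : ⇑(shift h ψ - ψ - (h : ℂ) • SchwartzMap.derivCLM ℂ ℂ ψ : 𝓢(ℝ, ℂ))
        = (⇑(shift h ψ) - ⇑ψ) - (h : ℂ) • ⇑(SchwartzMap.derivCLM ℂ ℂ ψ) := by
      ext u; simp
    have c1 : ContDiffAt ℝ n (⇑(shift h ψ) - ⇑ψ) t := (cd _).sub (cd _)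
    have c2 : ContDiffAt ℝ n ((h : ℂ) • ⇑(SchwartzMap.derivCLM ℂ ℂ ψ)) t :=
      (cd (SchwartzMap.derivCLM ℂ ℂ ψ)).const_smul (h : ℂ)
    rw [e1, iteratedDeriv_sub c1 c2, iteratedDeriv_sub (cd _) (cd _), iteratedDeriv_const_smul_field,
      iteratedDeriv_shift, iteratedDeriv_derivCLM]
    rfl
  rw [e]
  -- pointwise bound of the second derivative near t
  set M := 2 ^ k * B / (1 + |t|) ^ k with hM
  have hM0 : 0 ≤ M := by positivity
  have b2 : ∀ u : ℝ, |u| ≤ 1 → ‖iteratedDeriv (n + 2) ψ (u + t)‖ ≤ M := by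
    intro u hu
    rw [hM, le_div_iff₀ (by positivity)]
    have h1 : 1 + |t| ≤ 2 * (1 + |u + t|) := by
      have : |t| ≤ |u + t| + |u| := by
        have := abs_sub (u + t) u
        simpa using this
      have := abs_nonneg (u + t)
      linarith
    calc ‖iteratedDeriv (n + 2) ψ (u + t)‖ * (1 + |t|) ^ k
        ≤ ‖iteratedDeriv (n + 2) ψ (u + t)‖ * (2 * (1 + |u + t|)) ^ k := by gcongr
      _ = 2 ^ k * ((1 + |u + t|) ^ k * ‖iteratedDeriv (n + 2) ψ (u + t)‖) := by
        rw [mul_pow]; ring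
      _ ≤ 2 ^ k * B := by
        have := one_add_pow_le ψ k (n + 2) (u + t)
        gcongr
  have hseg : ∀ u ∈ uIcc (0 : ℝ) h, |u| ≤ |h| := by
    intro u hu
    have := abs_sub_left_of_mem_uIcc hu
    simpa using this
  have sh : ∀ m (u : ℝ), HasDerivAt (fun u => iteratedDeriv m ψ (u + t))
      (iteratedDeriv (m + 1) ψ (u + t)) u := fun m u => (hd m (u + t)).comp_add_const u t
  have b1 : ∀ u ∈ uIcc (0 : ℝ) h,
      ‖iteratedDeriv (n + 1) ψ (u + t) - iteratedDeriv (n + 1) ψ t‖ ≤ M * |h| := by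
    intro u hu
    have := (convex_uIcc (0 : ℝ) h).norm_image_sub_le_of_norm_hasDerivWithin_le
      (fun v hv => (sh (n + 1) v).hasDerivWithinAt)
      (fun v hv => b2 v ((hseg v hv).trans hh)) left_mem_uIcc hu
    simp only [zero_add, sub_zero, Real.norm_eq_abs] at this
    exact this.trans (mul_le_mul_of_nonneg_left (hseg u hu) hM0)
  have b0 : ‖iteratedDeriv n ψ (h + t) - iteratedDeriv n ψ t - h * iteratedDeriv (n + 1) ψ t‖
      ≤ M * h ^ 2 := by
    have := (convex_uIcc (0 : ℝ) h).norm_image_sub_le_of_norm_hasDerivWithin_le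
      (f := fun u : ℝ => iteratedDeriv n ψ (u + t) - (u : ℂ) * iteratedDeriv (n + 1) ψ t)
      (fun v hv => ((sh n v).sub
        ((Complex.ofRealCLM.hasDerivAt (x := v)).mul_const _)).hasDerivWithinAt)
      (C := M * |h|)
      (fun v hv => by simpa using b1 v hv) left_mem_uIcc right_mem_uIcc
    simp only [zero_add, sub_zero, Real.norm_eq_abs, Complex.ofReal_zero, zero_mul] at this
    calc _ = ‖iteratedDeriv n ψ (h + t) - h * iteratedDeriv (n + 1) ψ t - iteratedDeriv n ψ t‖ := by
          congr 1; ring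
      _ ≤ M * |h| * |h| := this
      _ = M * h ^ 2 := by rw [mul_assoc, ← sq, sq_abs]
  calc |t| ^ k * _ ≤ (1 + |t|) ^ k * (M * h ^ 2) := by
        gcongr
        linarith
    _ = 2 ^ k * B * h ^ 2 := by
        rw [hM]; field_simp

theorem hasDerivAt_shift (L : 𝓢(ℝ, ℂ) →L[ℂ] ℂ) (ψ : 𝓢(ℝ, ℂ)) (x : ℝ) :
    HasDerivAt (fun x => L (shift x ψ)) (L (shift x (SchwartzMap.derivCLM ℂ ℂ ψ))) x := by
  obtain ⟨m, C, hC, hL⟩ := clm_bound (L.comp (shift x))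
  choose D hD0 hD using shift_taylor ψ
  rw [hasDerivAt_iff_isLittleO_nhds_zero]
  refine Asymptotics.IsBigO.trans_isLittleO (g := fun h : ℝ => h ^ 2) ?_ ?_
  · refine Asymptotics.IsBigO.of_bound (C * ∑ p ∈ Finset.Iic m, D p.1 p.2) ?_
    filter_upwards [Metric.closedBall_mem_nhds (0 : ℝ) one_pos] with h hh
    have hh' : |h| ≤ 1 := by simpa using hh
    have e : L (shift (x + h) ψ) - L (shift x ψ) - h • L (shift x (SchwartzMap.derivCLM ℂ ℂ ψ))
        = (L.comp (shift x)) (shift h ψ - ψ - (h : ℂ) • SchwartzMap.derivCLM ℂ ℂ ψ) := by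
      have e1 : shift (x + h) ψ = shift x (shift h ψ) := by
        ext t
        simp only [shift_apply]
        congr 1; ring
      rw [e1]
      simp
    rw [e]
    refine (hL _).trans ?_
    rw [mul_assoc, Finset.sum_mul]
    refine mul_le_mul_of_nonneg_left (Finset.sum_le_sum fun p _ => ?_) hC
    simpa using hD p.1 p.2 h hh'
  · exact (Asymptotics.isLittleO_pow_id one_lt_two)

theorem iteratedDeriv_pairing_shift (L : 𝓢(ℝ, ℂ) →L[ℂ] ℂ) (ψ : 𝓢(ℝ, ℂ)) (n : ℕ) :
    iteratedDeriv n (fun x => L (shift x ψ)) =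
      fun x => L (shift x ((SchwartzMap.derivCLM ℂ ℂ)^[n] ψ)) := by
  induction n with
  | zero => simp
  | succ n ih =>
    rw [iteratedDeriv_succ, ih]
    funext x
    rw [(hasDerivAt_shift L _ x).deriv, Function.iterate_succ_apply']

theorem contDiff_pairing_shift (L : 𝓢(ℝ, ℂ) →L[ℂ] ℂ) (ψ : 𝓢(ℝ, ℂ)) :
    ContDiff ℝ ∞ (fun x => L (shift x ψ)) := by
  refine contDiff_of_differentiable_iteratedDeriv fun m _ => ?_
  rw [iteratedDeriv_pairing_shift]
  exact fun x => (hasDerivAt_shift L _ x).differentiableAt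

/-- Decay of `x ↦ ⟨g(t), χ(t) ψ(x + t)⟩` on the half-line `x ≥ -2`. -/
theorem pairing_shift_decay (g : 𝓢(ℝ, ℂ) →L[ℂ] ℂ) (k n : ℕ) :
    ∃ (s : Finset (ℕ × ℕ)) (C : ℝ), 0 ≤ C ∧ ∀ (ψ : 𝓢(ℝ, ℂ)) (x : ℝ), -2 ≤ x →
      |x| ^ k * ‖g (SchwartzMap.smulLeftCLM ℂ cutoff
        (shift x ((SchwartzMap.derivCLM ℂ ℂ)^[n] ψ)))‖ ≤
        C * s.sup (schwartzSeminormFamily ℂ ℝ ℂ) ψ := by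
  obtain ⟨m, C, hC, hg⟩ := clm_bound g
  choose K hK0 hK using cutoff_mul_bound
  set s : Finset (ℕ × ℕ) := Finset.Iic (k + m.1, n + m.2) with hs
  set S : Seminorm ℂ 𝓢(ℝ, ℂ) := s.sup (schwartzSeminormFamily ℂ ℝ ℂ) with hS
  refine ⟨s, C * ∑ p ∈ Finset.Iic m, K p.2 * (5 ^ (k + p.1) * 2 ^ (k + p.1)),
    mul_nonneg hC (Finset.sum_nonneg fun p _ => mul_nonneg (hK0 _) (by positivity)), ?_⟩
  intro ψ x hx
  set θ := shift x ((SchwartzMap.derivCLM ℂ ℂ)^[n] ψ) with hθ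
  have key : ∀ p ∈ Finset.Iic m, |x| ^ k * SchwartzMap.seminorm ℂ p.1 p.2
      (SchwartzMap.smulLeftCLM ℂ cutoff θ) ≤ K p.2 * (5 ^ (k + p.1) * 2 ^ (k + p.1)) * S ψ := by
    intro p hp
    have hp' := Finset.mem_Iic.1 hp
    have hR : 0 ≤ K p.2 * (5 ^ (k + p.1) * 2 ^ (k + p.1)) * S ψ :=
      mul_nonneg (mul_nonneg (hK0 _) (by positivity)) (apply_nonneg _ _)
    by_cases hx0 : |x| ^ k = 0
    · rw [hx0, zero_mul]; exact hR
    have hxp : 0 < |x| ^ k := lt_of_le_of_ne (by positivity) (Ne.symm hx0)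
    rw [← le_div_iff₀' hxp]
    refine SchwartzMap.seminorm_le_bound ℂ p.1 p.2 _ (by positivity) fun t => ?_
    rw [le_div_iff₀' hxp, ← mul_assoc, mul_assoc (K p.2)]
    have e2 : ⇑(SchwartzMap.smulLeftCLM ℂ cutoff θ) = fun t => cutoff t * θ t := by
      ext t
      rw [SchwartzMap.smulLeftCLM_apply_apply hasTemperateGrowth_cutoff, smul_eq_mul]
    rw [e2]
    refine hK p.2 θ (θ.smooth ⊤) _ _ t (by positivity)
      (mul_nonneg (by positivity) (apply_nonneg _ _)) fun ht j hj => ?_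
    rw [norm_iteratedFDeriv_eq_norm_iteratedDeriv, hθ, iteratedDeriv_shift, iterate_derivCLM,
      iteratedDeriv_eq_iterate, iteratedDeriv_eq_iterate, ← Function.iterate_add_apply,
      ← iteratedDeriv_eq_iterate]
    have a1 : |x| ≤ 5 * (1 + |x + t|) := by
      have := abs_nonneg (x + t)
      have := le_abs_self (x + t)
      rw [abs_le]; constructor <;> linarith
    have a2 : ‖t‖ ≤ 5 * (1 + |x + t|) := by
      have := abs_nonneg (x + t)
      have := le_abs_self (x + t)
      rw [Real.norm_eq_abs, abs_le]; constructor <;> linarith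
    have a3 := one_add_pow_le ψ (k + p.1) (j + n) (x + t)
    have a4 : (Finset.Iic (k + p.1, j + n)).sup (schwartzSeminormFamily ℂ ℝ ℂ) ψ ≤ S ψ := by
      apply Seminorm.le_def.1
      refine Finset.sup_mono (Finset.Iic_subset_Iic.2 ⟨?_, ?_⟩)
      · have := hp'.1
        simp only; omega
      · have := hp'.2
        simp only; omega
    calc |x| ^ k * ‖t‖ ^ p.1 * ‖iteratedDeriv (j + n) ψ (x + t)‖
        ≤ (5 * (1 + |x + t|)) ^ k * (5 * (1 + |x + t|)) ^ p.1 *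
          ‖iteratedDeriv (j + n) ψ (x + t)‖ := by gcongr
      _ = 5 ^ (k + p.1) * ((1 + |x + t|) ^ (k + p.1) * ‖iteratedDeriv (j + n) ψ (x + t)‖) := by
        rw [← pow_add, mul_pow]; ring
      _ ≤ 5 ^ (k + p.1) * (2 ^ (k + p.1) * S ψ) := by
        refine mul_le_mul_of_nonneg_left ?_ (by positivity)
        exact a3.trans (mul_le_mul_of_nonneg_left a4 (by positivity))
      _ = _ := by ring
  calc |x| ^ k * ‖g (SchwartzMap.smulLeftCLM ℂ cutoff θ)‖
      ≤ |x| ^ k * (C * ∑ p ∈ Finset.Iic m, SchwartzMap.seminorm ℂ p.1 p.2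
        (SchwartzMap.smulLeftCLM ℂ cutoff θ)) := by
        gcongr
        exact hg _
    _ = C * ∑ p ∈ Finset.Iic m, |x| ^ k * SchwartzMap.seminorm ℂ p.1 p.2
        (SchwartzMap.smulLeftCLM ℂ cutoff θ) := by
        rw [← Finset.mul_sum]; ring
    _ ≤ C * ∑ p ∈ Finset.Iic m, K p.2 * (5 ^ (k + p.1) * 2 ^ (k + p.1)) * S ψ := by
        exact mul_le_mul_of_nonneg_left (Finset.sum_le_sum key) hC
    _ = _ := by rw [← Finset.sum_mul]; ring

/-- For a tempered distribution `g`, the continuous map `𝓢 → 𝓢` sending `ψ` to the function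
`x ↦ χ(x) ⟨g(t), χ(t) ψ(x + t)⟩`, where `χ` is the cutoff function. -/
noncomputable def convTest (g : 𝓢(ℝ, ℂ) →L[ℂ] ℂ) : 𝓢(ℝ, ℂ) →L[ℂ] 𝓢(ℝ, ℂ) :=
  SchwartzMap.mkCLM
    (fun ψ x => cutoff x * g (SchwartzMap.smulLeftCLM ℂ cutoff (shift x ψ)))
    (fun ψ θ x => by simp [mul_add])
    (fun a ψ x => by simp; ring)
    (fun ψ => contDiff_cutoff.mul
      (contDiff_pairing_shift (g.comp (SchwartzMap.smulLeftCLM ℂ cutoff)) ψ))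
    (by
      rintro ⟨k, n⟩
      obtain ⟨K, hK0, hK⟩ := cutoff_mul_bound n
      choose s C hC0 hC using fun j => pairing_shift_decay g k j
      set s' := (Finset.range (n + 1)).biUnion s with hs'
      set C' := ∑ j ∈ Finset.range (n + 1), C j with hC'
      have hC'0 : 0 ≤ C' := Finset.sum_nonneg fun j _ => hC0 j
      refine ⟨s', K * C', mul_nonneg hK0 hC'0, fun ψ x => ?_⟩
      rw [mul_assoc]
      refine hK _ (contDiff_pairing_shift (g.comp (SchwartzMap.smulLeftCLM ℂ cutoff)) ψ) _ _ x
        (by positivity) (mul_nonneg hC'0 (apply_nonneg _ _)) fun hx j hj => ?_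
      rw [norm_iteratedFDeriv_eq_norm_iteratedDeriv, iteratedDeriv_pairing_shift]
      have hj' : j ∈ Finset.range (n + 1) := Finset.mem_range.2 (by omega)
      have h1 : C j ≤ C' := Finset.single_le_sum (fun i _ => hC0 i) hj'
      have h2 : (s j).sup (schwartzSeminormFamily ℂ ℝ ℂ) ψ ≤
          s'.sup (schwartzSeminormFamily ℂ ℝ ℂ) ψ :=
        Seminorm.le_def.1 (Finset.sup_mono (Finset.subset_biUnion_of_mem s hj')) ψ
      exact (hC j ψ x hx).trans (mul_le_mul h1 h2 (apply_nonneg _ _) hC'0))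

theorem convTest_apply (g : 𝓢(ℝ, ℂ) →L[ℂ] ℂ) (ψ : 𝓢(ℝ, ℂ)) (x : ℝ) :
    convTest g ψ x = cutoff x * g (SchwartzMap.smulLeftCLM ℂ cutoff (shift x ψ)) := rfl

/-! ### The space `S'_+` -/

/-- `S'_+`: tempered distributions on the line supported in `[0, ∞)`, that is, vanishing on all
test functions whose support lies in `(-∞, 0)`. Its instance topology is the one induced by
Mathlib's (pointwise, that is weak-star) topology of tempered distributions. -/
def TemperedPlus : Submodule ℂ 𝓢'(ℝ, ℂ) where
  carrier := {y | Distribution.IsVanishingOn y (Iio (0 : ℝ))}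
  add_mem' {y z} hy hz ψ hψ := by
    change y ψ + z ψ = 0
    rw [hy ψ hψ, hz ψ hψ, add_zero]
  zero_mem' ψ _ := rfl
  smul_mem' c y hy ψ hψ := by
    change c • y ψ = 0
    rw [hy ψ hψ, smul_zero]

/-- A tempered distribution as an element of the topological dual of `𝓢`. -/
noncomputable def toDual : 𝓢'(ℝ, ℂ) ≃ₗ[ℂ] (𝓢(ℝ, ℂ) →L[ℂ] ℂ) :=
  (ContinuousLinearMap.toUniformConvergenceCLM (RingHom.id ℂ) ℂ
    {s : Set 𝓢(ℝ, ℂ) | s.Finite}).symm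

theorem toDual_apply (y : 𝓢'(ℝ, ℂ)) (ψ : 𝓢(ℝ, ℂ)) : toDual y ψ = y ψ := rfl

theorem toDual_symm_apply (L : 𝓢(ℝ, ℂ) →L[ℂ] ℂ) (ψ : 𝓢(ℝ, ℂ)) : toDual.symm L ψ = L ψ := rfl

/-- The strong topology of `S'_+`: the one induced by the strong dual of `𝓢`, that is by the
topology of uniform convergence on bounded sets of `𝓢`. -/
@[reducible] noncomputable def strongTopology : TopologicalSpace TemperedPlus :=
  TopologicalSpace.induced (fun y => toDual y.1) inferInstance

/-! ### Convolution and fractional derivatives in `S'_+` -/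

/-- The convolution `f * g` in `S'_+`:
`⟨f * g, ψ⟩ = ⟨f(x), χ(x) ⟨g(t), χ(t) ψ(x + t)⟩⟩`, with `χ` a smooth cutoff equal to `1` in a
neighbourhood of `[0, ∞)` and to `0` near `-∞`. -/
noncomputable def conv (f g : TemperedPlus) : TemperedPlus :=
  ⟨toDual.symm ((toDual f.1).comp (convTest (toDual g.1))), by
    intro ψ hψ
    rw [toDual_symm_apply]
    change f.1 (convTest (toDual g.1) ψ) = 0
    have h0 : (tsupport ψ)ᶜ ∈ 𝓝 (0 : ℝ) :=
      (isClosed_tsupport ψ).isOpen_compl.mem_nhds fun h => lt_irrefl (0 : ℝ) (hψ h)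
    obtain ⟨ε, hε, hball⟩ := Metric.mem_nhds_iff.1 h0
    have hz : ∀ u : ℝ, -ε < u → ψ u = 0 := by
      intro u hu
      by_contra hne
      have h1 : u ∈ tsupport ψ := subset_tsupport _ hne
      have h2 : u < 0 := hψ h1
      refine hball (?_ : u ∈ Metric.ball (0 : ℝ) ε) h1
      rw [mem_ball_zero_iff, Real.norm_eq_abs, abs_of_neg h2]
      linarith
    refine f.2 _ ((closure_minimal ?_ isClosed_Iic).trans (Iic_subset_Iio.2
      (show -(ε / 2) < 0 by linarith)))
    intro x hx
    by_contra hx'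
    refine hx ?_
    rw [convTest_apply]
    refine mul_eq_zero_of_right _ (g.2 _ ((closure_minimal ?_ isClosed_Iic).trans (Iic_subset_Iio.2
      (show -(ε / 2) < 0 by linarith))))
    intro t ht
    by_contra ht'
    refine ht ?_
    rw [SchwartzMap.smulLeftCLM_apply_apply hasTemperateGrowth_cutoff, shift_apply,
      hz (x + t) (by simp only [mem_Iic, not_le] at hx' ht'; linarith), smul_zero]⟩

theorem conv_apply (f g : TemperedPlus) (ψ : 𝓢(ℝ, ℂ)) :
    (conv f g).1 ψ = f.1 (convTest (toDual g.1) ψ) := rfl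

theorem rpow_bound_integrable {α : ℝ} (hα : 0 < α) (N : ℕ) (hN : α < N) :
    IntegrableOn (fun x : ℝ => if x ≤ 1 then x ^ (α - 1) else x ^ (α - 1 - N)) (Ioi 0) := by
  rw [← Ioc_union_Ioi_eq_Ioi (zero_le_one (α := ℝ))]
  refine IntegrableOn.union ?_ ?_
  · have h : IntegrableOn (fun x : ℝ => x ^ (α - 1)) (Ioc 0 1) :=
      (intervalIntegrable_iff_integrableOn_Ioc_of_le zero_le_one).1
        (intervalIntegral.intervalIntegrable_rpow' (by linarith))
    exact h.congr_fun (fun x hx => by simp [hx.2]) measurableSet_Ioc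
  · have h : IntegrableOn (fun x : ℝ => x ^ (α - 1 - N)) (Ioi 1) :=
      integrableOn_Ioi_rpow_of_lt (by linarith) one_pos
    refine h.congr_fun (fun x hx => ?_) measurableSet_Ioi
    simp only [not_le.2 (show (1 : ℝ) < x from hx), if_false]

theorem rpow_mul_bound {α : ℝ} (N : ℕ) (ψ : 𝓢(ℝ, ℂ)) {x : ℝ} (hx : 0 < x) :
    ‖((x ^ (α - 1) : ℝ) : ℂ) * ψ x‖ ≤ (if x ≤ 1 then x ^ (α - 1) else x ^ (α - 1 - N)) *
      (({(0, 0), (N, 0)} : Finset (ℕ × ℕ)).sup (schwartzSeminormFamily ℂ ℝ ℂ) ψ) := by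
  have hp : ∀ p ∈ ({(0, 0), (N, 0)} : Finset (ℕ × ℕ)), SchwartzMap.seminorm ℂ p.1 p.2 ψ ≤
      ({(0, 0), (N, 0)} : Finset (ℕ × ℕ)).sup (schwartzSeminormFamily ℂ ℝ ℂ) ψ := fun p hp =>
    Seminorm.le_def.1 (Finset.le_sup (f := schwartzSeminormFamily ℂ ℝ ℂ) hp) ψ
  rw [norm_mul, Complex.norm_real, Real.norm_of_nonneg (by positivity)]
  split_ifs with h1
  · exact mul_le_mul_of_nonneg_left ((SchwartzMap.norm_le_seminorm ℂ ψ x).trans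
      (hp (0, 0) (by simp))) (by positivity)
  · have h2 := (SchwartzMap.norm_pow_mul_le_seminorm ℂ ψ N x).trans (hp (N, 0) (by simp))
    rw [Real.norm_of_nonneg hx.le] at h2
    calc x ^ (α - 1) * ‖ψ x‖ = x ^ (α - 1 - N) * (x ^ N * ‖ψ x‖) := by
          rw [← mul_assoc, ← Real.rpow_natCast x N, ← Real.rpow_add hx]
          congr 2; ring
      _ ≤ _ := mul_le_mul_of_nonneg_left h2 (by positivity)

theorem rpow_mul_integrable {α : ℝ} (hα : 0 < α) (ψ : 𝓢(ℝ, ℂ)) :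
    IntegrableOn (fun x : ℝ => ((x ^ (α - 1) : ℝ) : ℂ) * ψ x) (Ioi 0) := by
  obtain ⟨N, hN⟩ := exists_nat_gt α
  refine Integrable.mono' ((rpow_bound_integrable hα N hN).mul_const _) ?_
    ((ae_restrict_iff' measurableSet_Ioi).2 (.of_forall fun x hx => rpow_mul_bound N ψ hx))
  refine AEStronglyMeasurable.mul ?_ ψ.continuous.aestronglyMeasurable
  exact (Complex.measurable_ofReal.comp
    (measurable_id.pow_const (α - 1))).aestronglyMeasurable

/-- `f_α(x) = H(x) x^(α-1) / Γ(α)` for `α > 0`, as a functional on `𝓢`. -/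
noncomputable def powerDual (α : ℝ) (hα : 0 < α) : 𝓢(ℝ, ℂ) →L[ℂ] ℂ :=
  SchwartzMap.mkCLMtoNormedSpace
    (fun ψ => (Real.Gamma α : ℂ)⁻¹ * ∫ x in Ioi (0 : ℝ), ((x ^ (α - 1) : ℝ) : ℂ) * ψ x)
    (fun ψ θ => by
      rw [← mul_add, ← integral_add (rpow_mul_integrable hα ψ) (rpow_mul_integrable hα θ)]
      simp [mul_add])
    (fun a ψ => by
      have h : ∀ x : ℝ, ((x ^ (α - 1) : ℝ) : ℂ) * (a • ψ) x =
          a * (((x ^ (α - 1) : ℝ) : ℂ) * ψ x) := fun x => mul_left_comm _ a (ψ x)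
      simp only [h, RingHom.id_apply, smul_eq_mul, integral_const_mul]
      ring)
    (by
      obtain ⟨N, hN⟩ := exists_nat_gt α
      refine ⟨{(0, 0), (N, 0)}, ‖(Real.Gamma α : ℂ)⁻¹‖ *
        ∫ x in Ioi (0 : ℝ), (if x ≤ 1 then x ^ (α - 1) else x ^ (α - 1 - N)),
        mul_nonneg (norm_nonneg _) (setIntegral_nonneg measurableSet_Ioi fun x hx => ?_),
        fun ψ => ?_⟩
      · have : (0 : ℝ) < x := hx
        positivity
      · rw [norm_mul, mul_assoc, ← integral_mul_const]
        refine mul_le_mul_of_nonneg_left ?_ (norm_nonneg _)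
        exact norm_integral_le_of_norm_le ((rpow_bound_integrable hα N hN).mul_const _)
          ((ae_restrict_iff' measurableSet_Ioi).2 (.of_forall fun x hx => rpow_mul_bound N ψ hx)))

/-- `f_α(x) = H(x) x^(α-1) / Γ(α)` for `α > 0`, as an element of `S'_+`. -/
noncomputable def powerPos (α : ℝ) (hα : 0 < α) : TemperedPlus :=
  ⟨toDual.symm (powerDual α hα), by
    intro ψ hψ
    rw [toDual_symm_apply]
    change (Real.Gamma α : ℂ)⁻¹ * ∫ x in Ioi (0 : ℝ), ((x ^ (α - 1) : ℝ) : ℂ) * ψ x = 0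
    rw [setIntegral_eq_zero_of_forall_eq_zero, mul_zero]
    intro x hx
    rw [image_eq_zero_of_notMem_tsupport (f := ψ) (x := x)
      fun h => lt_asymm (show (0 : ℝ) < x from hx) (hψ h), mul_zero]⟩

theorem powerPos_apply (α : ℝ) (hα : 0 < α) (ψ : 𝓢(ℝ, ℂ)) : (powerPos α hα).1 ψ =
    (Real.Gamma α : ℂ)⁻¹ * ∫ x in Ioi (0 : ℝ), ((x ^ (α - 1) : ℝ) : ℂ) * ψ x := rfl

/-- The distributional derivative `d/dx` on `S'_+`. -/
noncomputable def derivPlus (y : TemperedPlus) : TemperedPlus :=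
  ⟨TemperedDistribution.derivCLM ℂ y.1, fun ψ hψ => by
    rw [TemperedDistribution.derivCLM_apply_apply, map_neg, neg_eq_zero]
    exact y.2 _ ((SchwartzMap.tsupport_derivCLM_subset ℂ ψ).trans hψ)⟩

/-- The family `f_α`, `α ∈ ℝ`, in `S'_+`: `f_α(x) = H(x) x^(α-1) / Γ(α)` for `α > 0`, and
`f_α = (d/dx)^N f_(α+N)` for `α ≤ 0`, with `N` the least natural number such that `α + N > 0`. -/
noncomputable def power (α : ℝ) : TemperedPlus :=
  if hα : 0 < α then powerPos α hα
  else derivPlus^[⌊-α⌋₊ + 1] (powerPos (α + (⌊-α⌋₊ + 1 : ℕ)) (by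
    have := Nat.lt_floor_add_one (-α)
    push_cast
    linarith))

/-- The left Riemann-Liouville derivative `D^γ y = f_(-γ) * y` of real order `γ` in `S'_+`
(a fractional integral when `γ < 0`). -/
noncomputable def fracDeriv (γ : ℝ) (y : TemperedPlus) : TemperedPlus := conv (power (-γ)) y

/-! ### The Laplace transform -/

theorem exp_decay {s : ℂ} (hs : 0 < s.re) (k : ℕ) : ∃ C : ℝ, 0 ≤ C ∧ ∀ t : ℝ, -2 ≤ t →
    |t| ^ k * Real.exp (-(s.re * t)) ≤ C := by
  have hc : Continuous fun t : ℝ => |t| ^ k * Real.exp (-(s.re * t)) := by fun_prop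
  have hl : Filter.Tendsto (fun t : ℝ => t ^ k * Real.exp (-(s.re * t))) Filter.atTop (𝓝 0) := by
    have := tendsto_rpow_mul_exp_neg_mul_atTop_nhds_zero k s.re hs
    simpa using this
  obtain ⟨R, hR⟩ := Filter.eventually_atTop.1 (hl.eventually (gt_mem_nhds zero_lt_one))
  obtain ⟨C, hC⟩ := (isCompact_Icc (a := (-2 : ℝ)) (b := max R 0)).bddAbove_image hc.continuousOn
  refine ⟨max C 1, by positivity, fun t ht => ?_⟩
  by_cases h : t ≤ max R 0
  · exact (hC ⟨t, ⟨ht, h⟩, rfl⟩).trans (le_max_left _ _)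
  · have h' := max_lt_iff.1 (not_le.1 h)
    rw [abs_of_pos h'.2]
    exact (hR t h'.1.le).le.trans (le_max_right _ _)

theorem iteratedDeriv_exp_neg (s : ℂ) (n : ℕ) :
    iteratedDeriv n (fun t : ℝ => Complex.exp (-(s * t))) =
      fun t : ℝ => (-s) ^ n * Complex.exp (-(s * t)) := by
  induction n with
  | zero => simp
  | succ n ih =>
    rw [iteratedDeriv_succ, ih]
    funext t
    have h : HasDerivAt (fun t : ℝ => Complex.exp (-(s * t)))
        (Complex.exp (-(s * t)) * (-(s * 1))) t :=
      (((Complex.ofRealCLM.hasDerivAt (x := t)).const_mul s).neg).cexp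
    rw [(h.const_mul _).deriv]
    ring

theorem contDiff_exp_neg (s : ℂ) : ContDiff ℝ ∞ (fun t : ℝ => Complex.exp (-(s * t))) :=
  ((contDiff_const.mul Complex.ofRealCLM.contDiff).neg).cexp

/-- The test function `t ↦ χ(t) e^(-st)`, for `Re s > 0`. -/
noncomputable def laplaceTest (s : ℂ) (hs : 0 < s.re) : 𝓢(ℝ, ℂ) where
  toFun t := cutoff t * Complex.exp (-(s * t))
  smooth' := contDiff_cutoff.mul (contDiff_exp_neg s)
  decay' := by
    intro k n
    obtain ⟨K, hK0, hK⟩ := cutoff_mul_bound n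
    obtain ⟨C, hC0, hC⟩ := exp_decay hs k
    have hM : 0 ≤ (∑ j ∈ Finset.range (n + 1), ‖s‖ ^ j) * C := by positivity
    refine ⟨_, fun t => hK _ (contDiff_exp_neg s) _ _ t (by positivity) hM fun ht j hj => ?_⟩
    rw [norm_iteratedFDeriv_eq_norm_iteratedDeriv, iteratedDeriv_exp_neg, norm_mul, norm_pow,
      norm_neg, Complex.norm_exp, Real.norm_eq_abs]
    have h1 : ‖s‖ ^ j ≤ ∑ j ∈ Finset.range (n + 1), ‖s‖ ^ j :=
      Finset.single_le_sum (f := fun j => ‖s‖ ^ j) (fun i _ => by positivity)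
        (Finset.mem_range.2 (by omega))
    have h2 := hC t ht
    have h3 : (-(s * (t : ℂ))).re = -(s.re * t) := by simp
    rw [h3, mul_left_comm]
    exact mul_le_mul h1 h2 (by positivity) (by positivity)

/-- The Laplace transform `ŷ(s) = ⟨y(t), χ(t) e^(-st)⟩`, `Re s > 0`, of `y ∈ S'_+`. -/
noncomputable def laplace (y : TemperedPlus) (s : ℂ) (hs : 0 < s.re) : ℂ :=
  y.1 (laplaceTest s hs)

/-- The Laplace transform does not depend on the choice of the cutoff function. -/
theorem laplace_eq (y : TemperedPlus) (s : ℂ) (hs : 0 < s.re) (ψ : 𝓢(ℝ, ℂ)) (a : ℝ) (ha : 0 < a)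
    (hψ : ∀ t : ℝ, -a < t → ψ t = Complex.exp (-(s * t))) : y.1 ψ = laplace y s hs := by
  have h : y.1 (ψ - laplaceTest s hs) = 0 := by
    have hb : 0 < min a 1 := by positivity
    refine y.2 _ ((closure_minimal ?_ isClosed_Iic).trans (Iic_subset_Iio.2
      (show -(min a 1) < 0 by linarith)))
    intro t ht
    by_contra ht'
    have ht2 : -(min a 1) < t := not_le.1 ht'
    have h1 := min_le_left a 1
    have h2 := min_le_right a 1
    refine ht ?_
    change ψ t - cutoff t * Complex.exp (-(s * t)) = 0
    rw [hψ t (by linarith), cutoff_of_ge (by linarith), one_mul, sub_self]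
  rwa [map_sub, sub_eq_zero] at h

/-! ### Compactly supported distributions -/

/-- The smooth functions `ℝ → ℂ`, as a linear subspace of all functions. -/
def smoothSubmodule : Submodule ℂ (ℝ → ℂ) where
  carrier := {f | ContDiff ℝ ∞ f}
  add_mem' {f g} hf hg := ContDiff.add (𝕜 := ℝ) (n := ∞) (f := f) (g := g) hf hg
  zero_mem' := (contDiff_const : ContDiff ℝ ∞ fun _ : ℝ => (0 : ℂ))
  smul_mem' c f hf := ContDiff.const_smul (𝕜 := ℝ) (n := ∞) (f := f) c hf

/-- The space `E(ℝ)` of all smooth functions `ℝ → ℂ`; a type of its own, so that it does not inherit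
the topology of pointwise convergence. -/
def SmoothFun : Type := smoothSubmodule

noncomputable instance : AddCommGroup SmoothFun := inferInstanceAs (AddCommGroup smoothSubmodule)

noncomputable instance : Module ℂ SmoothFun := inferInstanceAs (Module ℂ smoothSubmodule)

theorem SmoothFun.add_val (f g : SmoothFun) : (f + g).1 = f.1 + g.1 := rfl

theorem SmoothFun.smul_val (a : ℂ) (f : SmoothFun) : (a • f).1 = a • f.1 := rfl

theorem SmoothFun.contDiff (f : SmoothFun) : ContDiff ℝ ∞ f.1 := f.2

/-- The `j`-th derivative of a smooth function, as a continuous function. -/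
noncomputable def SmoothFun.derivC (j : ℕ) (f : SmoothFun) : C(ℝ, ℂ) :=
  ⟨iteratedDeriv j f.1, ContDiff.continuous_iteratedDeriv' j ((SmoothFun.contDiff f).of_le (by exact_mod_cast le_top))⟩

/-- The usual topology of `E(ℝ)`: locally uniform convergence of all derivatives. -/
noncomputable instance : TopologicalSpace SmoothFun :=
  ⨅ j : ℕ, TopologicalSpace.induced (SmoothFun.derivC j) inferInstance

/-- `E'(ℝ)`, the topological dual of `E(ℝ)`: the compactly supported distributions. -/
abbrev CompactDistribution := SmoothFun →L[ℂ] ℂ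

theorem regular_integrable {u : ℝ → ℂ} {c d : ℝ} (hu : ContinuousOn u (Icc c d))
    (hu0 : ∀ γ, γ ∉ Icc c d → u γ = 0) {f : ℝ → ℂ} (hf : Continuous f) :
    Integrable fun γ => u γ * f γ := by
  have h : IntegrableOn (fun γ => u γ * f γ) (Icc c d) :=
    (hu.mul hf.continuousOn).integrableOn_Icc
  refine (integrableOn_iff_integrable_of_support_subset ?_).1 h
  intro γ hγ
  by_contra hn
  exact hγ (by simp [hu0 γ hn])

/-- The distribution `f ↦ ∫ u(γ) f(γ) dγ` given by a function `u` that is continuous on `[c, d]`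
and vanishes outside. -/
noncomputable def regular (u : ℝ → ℂ) (c d : ℝ) (hu : ContinuousOn u (Icc c d))
    (hu0 : ∀ γ, γ ∉ Icc c d → u γ = 0) : CompactDistribution where
  toFun f := ∫ γ, u γ * f.1 γ
  map_add' f g := by
    rw [← integral_add (regular_integrable hu hu0 (SmoothFun.contDiff f).continuous)
      (regular_integrable hu hu0 (SmoothFun.contDiff g).continuous)]
    simp [SmoothFun.add_val, mul_add]
  map_smul' a f := by
    rw [RingHom.id_apply, smul_eq_mul, ← integral_const_mul]
    simp [SmoothFun.smul_val, mul_left_comm]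
  cont := by
    have h1 : Continuous fun g : C(ℝ, ℂ) => ∫ γ in Icc c d, u γ * g γ := by
      refine continuous_iff_continuousAt.2 fun g₀ => ?_
      refine continuousAt_of_dominated (bound := fun γ => ‖u γ‖ * (‖g₀ γ‖ + 1))
        (.of_forall fun g => ?_) ?_ ?_ (.of_forall fun γ => ?_)
      · exact (hu.mul g.continuous.continuousOn).aestronglyMeasurable measurableSet_Icc
      · have h := (ContinuousMap.tendsto_iff_forall_isCompact_tendstoUniformlyOn
          (f := g₀)).1 (Filter.tendsto_id (x := 𝓝 g₀)) (Icc c d) isCompact_Icc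
        filter_upwards [Metric.tendstoUniformlyOn_iff.1 h 1 one_pos] with g hg
        refine (ae_restrict_iff' measurableSet_Icc).2 (.of_forall fun γ hγ => ?_)
        rw [norm_mul]
        refine mul_le_mul_of_nonneg_left ?_ (norm_nonneg _)
        have h1 := hg γ hγ
        rw [dist_comm, dist_eq_norm] at h1
        have h2 := norm_le_insert' (g γ) (g₀ γ)
        simp only [id] at h1
        linarith
      · exact (hu.norm.mul (by fun_prop)).integrableOn_Icc
      · exact (continuous_const.mul (continuous_eval_const γ)).continuousAt
    have h2 : Continuous (SmoothFun.derivC 0) :=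
      continuous_iff_le_induced.2 (iInf_le _ 0)
    have h3 : (fun f : SmoothFun => ∫ γ, u γ * f.1 γ) =
        fun f => ∫ γ in Icc c d, u γ * SmoothFun.derivC 0 f γ := by
      funext f
      rw [← setIntegral_eq_integral_of_forall_compl_eq_zero (s := Icc c d)]
      · simp [SmoothFun.derivC]
      · intro γ hγ
        simp [hu0 γ hγ]
    rw [h3]
    exact h1.comp h2

/-- The function `γ ↦ s^γ` (principal branch), for `Re s > 0`. -/
noncomputable def powFun (s : ℂ) (hs : 0 < s.re) : SmoothFun :=
  ⟨fun γ : ℝ => s ^ (γ : ℂ), by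
    have hs0 : s ≠ 0 := by
      rintro rfl
      simp at hs
    have : (fun γ : ℝ => s ^ (γ : ℂ)) = fun γ : ℝ => Complex.exp (Complex.log s * γ) :=
      funext fun γ => Complex.cpow_def_of_ne_zero hs0 _
    change ContDiff ℝ ∞ fun γ : ℝ => s ^ (γ : ℂ)
    rw [this]
    exact (contDiff_const.mul Complex.ofRealCLM.contDiff).cexp⟩

/-- `w` is the distributed order fractional derivative `∫_(supp φ) φ(γ) D^γ y dγ` of `y`: for every
test function `ψ`, the function `γ ↦ ⟨D^γ y, ψ⟩` is smooth and
`⟨w, ψ⟩ = ⟨φ(γ), ⟨D^γ y, ψ⟩⟩`. This determines `w`. -/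
def IsDistributedOrderDeriv (φ : CompactDistribution) (y w : TemperedPlus) : Prop :=
  ∀ ψ : 𝓢(ℝ, ℂ), ∃ h : ContDiff ℝ ∞ (fun γ : ℝ => (fracDeriv γ y).1 ψ),
    w.1 ψ = φ ⟨fun γ : ℝ => (fracDeriv γ y).1 ψ, h⟩

end DistOrder

open DistOrder

/-!
Write `σ = ∫ φ(γ) f_(-γ) dγ` for the distribution `ψ ↦ ⟨φ(γ), ⟨f_(-γ), ψ⟩⟩` (`orderKernel`). By the
definition of the convolution, `⟨σ * y, ψ⟩ = ⟨φ(γ), ⟨D^γ y, ψ⟩⟩`, so the distributed order derivative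
of `y` is `σ * y`. Three facts then give everything.

* *`σ` is a tempered distribution* (`powerFamily`). Integrating by parts, `⟨f_α, ψ⟩` is, up to sign,
  the Mellin transform of `ψ^(N)` at `α + N` divided by `Γ(α + N)`, for any `N` with `α + N > 0`.
  Hence `γ ↦ ⟨f_(-γ), ψ⟩` extends to a holomorphic function on every disc, bounded there by a
  Schwartz seminorm of `ψ` (`exists_holomorphic_extension_power`). Smoothness in `γ` follows, and
  Cauchy's estimates bound all derivatives in `γ`, so `ψ ↦ (γ ↦ ⟨f_(-γ), ψ⟩)` is continuous from `𝓢`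
  to `E(ℝ)`.
* *Convolution in `S'_+` is commutative* (`conv_comm`). The Laplace transform turns convolution into
  multiplication (`laplace_conv`), and it is injective (`eq_zero_of_laplace_nat`): its values at
  `1, 2, 3, …` determine `y` on polynomials in `e^(-t)` without constant term, and by the Weierstrass
  theorem these approximate a test function vanishing near `+∞`, with finitely many derivatives and
  weights, on a neighbourhood of the support of `y`. Commutativity exhibits `y ↦ σ * y = y * σ` as the
  transpose of the continuous map `convTest σ` of `𝓢`, whence the continuity for both topologies.
* *The Laplace transform of `f_α` is `s^(-α)`* (`laplace_power`). For `α > 0` the function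
  `s^α ∫ x^(α-1) e^(-sx) dx` has derivative `0` on the right half-plane and equals `Γ(α)` at `s = 1`;
  the other orders follow by differentiating `f_α`. So `σ` has Laplace transform `⟨φ(γ), s^γ⟩`.
-/

/-! ### Locality and the Laplace transform of a convolution -/

namespace DistOrder

/-- An element of `S'_+` only depends on the test function near `[0, ∞)`. -/
theorem apply_eq_of_eqOn_Ioi (y : TemperedPlus) {ψ θ : 𝓢(ℝ, ℂ)} {a : ℝ} (ha : 0 < a)
    (h : ∀ t : ℝ, -a < t → ψ t = θ t) : y.1 ψ = y.1 θ := by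
  have h0 : y.1 (ψ - θ) = 0 := by
    refine y.2 _ ((closure_minimal ?_ isClosed_Iic).trans (Iic_subset_Iio.2
      (show -a < 0 by linarith)))
    intro t ht
    by_contra ht'
    refine ht ?_
    change ψ t - θ t = 0
    rw [h t (not_le.1 ht'), sub_self]
  rwa [map_sub, sub_eq_zero] at h0

theorem apply_eq_mul_laplace (y : TemperedPlus) {s : ℂ} (hs : 0 < s.re) (c : ℂ) {ψ : 𝓢(ℝ, ℂ)}
    {a : ℝ} (ha : 0 < a) (h : ∀ t : ℝ, -a < t → ψ t = c * Complex.exp (-(s * t))) :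
    y.1 ψ = c * laplace y s hs := by
  have h1 : y.1 ψ = y.1 (c • laplaceTest s hs) := by
    refine apply_eq_of_eqOn_Ioi y (a := min a 1) (by positivity) fun t ht => ?_
    have h1 := min_le_left a 1
    have h2 := min_le_right a 1
    rw [h t (by linarith)]
    change _ = c * (cutoff t * Complex.exp (-(s * t)))
    rw [cutoff_of_ge (by linarith), one_mul]
  rw [h1, map_smul]
  rfl

theorem laplaceTest_apply {s : ℂ} (hs : 0 < s.re) (t : ℝ) :
    laplaceTest s hs t = cutoff t * Complex.exp (-(s * t)) := rfl

/-- The Laplace transform turns convolution into multiplication: near `[0, ∞)` the test function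
`convTest g (laplaceTest s)` equals `x ↦ ĝ(s) e^(-sx)`. -/
theorem laplace_conv (f g : TemperedPlus) (s : ℂ) (hs : 0 < s.re) :
    laplace (conv f g) s hs = laplace f s hs * laplace g s hs := by
  rw [mul_comm]
  change f.1 (convTest (toDual g.1) (laplaceTest s hs)) = _
  refine apply_eq_mul_laplace f hs _ (a := 1 / 2) (by norm_num) fun x hx => ?_
  rw [convTest_apply, cutoff_of_ge (by linarith), one_mul, toDual_apply,
    apply_eq_mul_laplace g hs (Complex.exp (-(s * x))) (a := 1 / 2) (by norm_num), mul_comm]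
  intro t ht
  rw [SchwartzMap.smulLeftCLM_apply_apply hasTemperateGrowth_cutoff, shift_apply,
    laplaceTest_apply, cutoff_of_ge (by linarith), cutoff_of_ge (by linarith), one_smul, one_mul,
    ← Complex.exp_add]
  congr 1
  push_cast
  ring

end DistOrder

/-! ### Injectivity of the Laplace transform -/

namespace DistOrder

/-- The exponential polynomial `∑_(k < N) c_k e^(-(k+1)t)`, a polynomial without constant term in
`e^(-t)`. -/
noncomputable def expSum (N : ℕ) (c : ℕ → ℂ) (t : ℝ) : ℂ :=
  ∑ k ∈ Finset.range N, c k * Complex.exp (-(((k : ℂ) + 1) * t))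

theorem contDiff_expSum (N : ℕ) (c : ℕ → ℂ) : ContDiff ℝ ∞ (expSum N c) :=
  ContDiff.sum fun k _ => contDiff_const.mul (contDiff_exp_neg ((k : ℂ) + 1))

theorem hasDerivAt_expSum_primitive (N : ℕ) (c : ℕ → ℂ) (t : ℝ) :
    HasDerivAt (expSum N fun k => -c k / (k + 1)) (expSum N c t) t := by
  refine HasDerivAt.fun_sum fun k _ => ?_
  have h : HasDerivAt (fun t : ℝ => Complex.exp (-(((k : ℂ) + 1) * t)))
      (Complex.exp (-(((k : ℂ) + 1) * t)) * (-(((k : ℂ) + 1) * 1))) t :=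
    (((Complex.ofRealCLM.hasDerivAt (x := t)).const_mul ((k : ℂ) + 1)).neg).cexp
  refine (h.const_mul (-c k / (k + 1))).congr_deriv ?_
  have h0 : (k : ℂ) + 1 ≠ 0 := Nat.cast_add_one_ne_zero k
  rw [mul_one, mul_comm (Complex.exp _), ← mul_assoc, mul_neg, div_mul_cancel₀ _ h0, neg_neg]

theorem tendsto_expSum (N : ℕ) (c : ℕ → ℂ) :
    Filter.Tendsto (expSum N c) Filter.atTop (𝓝 0) := by
  have h : ∀ k ∈ Finset.range N, Filter.Tendsto
      (fun t : ℝ => c k * Complex.exp (-(((k : ℂ) + 1) * t))) Filter.atTop (𝓝 (c k * 0)) := by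
    intro k _
    refine Filter.Tendsto.const_mul _ (tendsto_zero_iff_norm_tendsto_zero.2 ?_)
    have e : ∀ t : ℝ, ‖Complex.exp (-(((k : ℂ) + 1) * t))‖ = Real.exp (-(((k : ℝ) + 1) * t)) := by
      intro t
      rw [Complex.norm_exp]
      simp
    simp only [e]
    exact Real.tendsto_exp_neg_atTop_nhds_zero.comp
      (Filter.tendsto_id.const_mul_atTop (by positivity))
  have h1 := tendsto_finsetSum _ h
  simp only [mul_zero, Finset.sum_const_zero] at h1
  exact h1

/-- Weierstrass approximation of `u ↦ u⁻¹ ψ(-log u)`, in the variable `u = e^(-t) ∈ (0, e²]`. -/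
theorem exists_expSum_near {ψ : ℝ → ℂ} (hψ : Continuous ψ) {R : ℝ} (hR : ∀ t, R ≤ t → ψ t = 0)
    {ε : ℝ} (hε : 0 < ε) : ∃ (N : ℕ) (c : ℕ → ℂ), ∀ t : ℝ, -2 ≤ t →
      ‖expSum N c t - ψ t‖ ≤ ε * Real.exp (-t) := by
  -- truncating `u` at `e^(-R)` keeps the function continuous at `0` without changing it
  set v : ℝ → ℝ := fun u => max u (Real.exp (-R)) with hv
  have hvpos : ∀ u, 0 < v u := fun u => lt_max_of_lt_right (Real.exp_pos _)
  have hvc : Continuous v := continuous_id.max continuous_const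
  set G : ℝ → ℂ := fun u => ((v u)⁻¹ : ℝ) * ψ (-Real.log (v u)) with hG
  have hGc : Continuous G := by
    refine (Complex.continuous_ofReal.comp (hvc.inv₀ fun u => (hvpos u).ne')).mul (hψ.comp ?_)
    exact (hvc.log fun u => (hvpos u).ne').neg
  have hGexp : ∀ t : ℝ, (Real.exp (-t) : ℂ) * G (Real.exp (-t)) = ψ t := by
    intro t
    rcases le_total t R with h | h
    · have e : v (Real.exp (-t)) = Real.exp (-t) :=
        max_eq_left (Real.exp_le_exp.2 (neg_le_neg h))
      simp only [hG, e, Real.log_exp, neg_neg]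
      rw [← mul_assoc, ← Complex.ofReal_mul, mul_inv_cancel₀ (Real.exp_pos _).ne',
        Complex.ofReal_one, one_mul]
    · have e : v (Real.exp (-t)) = Real.exp (-R) :=
        max_eq_right (Real.exp_le_exp.2 (neg_le_neg h))
      simp [hG, e, hR t h, hR R le_rfl]
  obtain ⟨p, hp⟩ := exists_polynomial_near_of_continuousOn 0 (Real.exp 2) (fun u => (G u).re)
    (Complex.continuous_re.comp hGc).continuousOn (ε / 2) (by positivity)
  obtain ⟨q, hq⟩ := exists_polynomial_near_of_continuousOn 0 (Real.exp 2) (fun u => (G u).im)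
    (Complex.continuous_im.comp hGc).continuousOn (ε / 2) (by positivity)
  set N := max p.natDegree q.natDegree + 1 with hN
  refine ⟨N, fun k => p.coeff k + q.coeff k * Complex.I, fun t ht => ?_⟩
  set u := Real.exp (-t) with hu
  have hu0 : 0 < u := Real.exp_pos _
  have hmem : u ∈ Icc 0 (Real.exp 2) := ⟨hu0.le, Real.exp_le_exp.2 (by linarith)⟩
  have e1 : expSum N (fun k => p.coeff k + q.coeff k * Complex.I) t
      = (u : ℂ) * ((p.eval u : ℝ) + (q.eval u : ℝ) * Complex.I) := by
    rw [p.eval_eq_sum_range' (n := N) (by omega), q.eval_eq_sum_range' (n := N) (by omega), expSum]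
    push_cast
    rw [Finset.sum_mul, ← Finset.sum_add_distrib, Finset.mul_sum]
    refine Finset.sum_congr rfl fun k _ => ?_
    have e2 : Complex.exp (-(((k : ℂ) + 1) * t)) = (u : ℂ) ^ (k + 1) := by
      rw [hu, Complex.ofReal_exp, ← Complex.exp_nat_mul]
      congr 1
      push_cast
      ring
    rw [e2]
    ring
  rw [e1, ← hGexp t, ← mul_sub, norm_mul, Complex.norm_real, Real.norm_of_nonneg hu0.le, mul_comm]
  refine mul_le_mul_of_nonneg_right ?_ hu0.le
  refine (Complex.norm_le_abs_re_add_abs_im _).trans ?_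
  have h1 := hp u hmem
  have h2 := hq u hmem
  simp only [Complex.sub_re, Complex.add_re, Complex.ofReal_re, Complex.mul_re, Complex.I_re,
    mul_zero, Complex.ofReal_im, Complex.I_im, mul_one, sub_self, add_zero, Complex.sub_im,
    Complex.add_im, Complex.mul_im, zero_add]
  linarith

theorem norm_le_of_deriv_le_exp {E E' : ℝ → ℂ} (hE : ∀ t, HasDerivAt E (E' t) t)
    (hc : Continuous E') (hl : Filter.Tendsto E Filter.atTop (𝓝 0)) {a ε : ℝ}
    (h : ∀ t, a ≤ t → ‖E' t‖ ≤ ε * Real.exp (-t)) {t : ℝ} (ht : a ≤ t) :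
    ‖E t‖ ≤ ε * Real.exp (-t) := by
  have hb : IntegrableOn (fun x => ε * Real.exp (-x)) (Ioi t) := by
    exact (integrableOn_exp_neg_Ioi t).const_mul ε
  have hle : ∀ᵐ x ∂volume.restrict (Ioi t), ‖E' x‖ ≤ ε * Real.exp (-x) :=
    (ae_restrict_iff' measurableSet_Ioi).2 (.of_forall fun x hx => h x (ht.trans (le_of_lt hx)))
  have h1 := integral_Ioi_of_hasDerivAt_of_tendsto' (fun x _ => hE x)
    (hb.mono' hc.aestronglyMeasurable hle) hl
  have h2 := norm_integral_le_of_norm_le hb hle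
  rw [h1, zero_sub, norm_neg, integral_const_mul, integral_exp_neg_Ioi] at h2
  exact h2

/-- Approximation by exponential polynomials together with derivatives up to order `m`. The step
from `ψ'` to `ψ` integrates from `∞`, which preserves the bound `ε e^(-t)`. -/
theorem exists_expSum_near_iteratedDeriv (m : ℕ) : ∀ {ψ : ℝ → ℂ}, ContDiff ℝ ∞ ψ →
    ∀ {R : ℝ}, (∀ t, R < t → ψ t = 0) → ∀ {ε : ℝ}, 0 < ε →
    ∃ (N : ℕ) (c : ℕ → ℂ), ∀ j ≤ m, ∀ t : ℝ, -2 ≤ t →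
      ‖iteratedDeriv j (fun t => expSum N c t - ψ t) t‖ ≤ ε * Real.exp (-t) := by
  induction m with
  | zero =>
    intro ψ hψ R hR ε hε
    obtain ⟨N, c, h⟩ := exists_expSum_near hψ.continuous (R := R + 1)
      (fun t ht => hR t (by linarith)) hε
    refine ⟨N, c, fun j hj t ht => ?_⟩
    obtain rfl : j = 0 := by omega
    simpa using h t ht
  | succ m ih =>
    intro ψ hψ R hR ε hε
    have hd : ContDiff ℝ ∞ (deriv ψ) := (contDiff_infty_iff_deriv.1 hψ).2
    have hR' : ∀ t, R < t → deriv ψ t = 0 := by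
      intro t ht
      have : ψ =ᶠ[𝓝 t] fun _ => (0 : ℂ) := by
        filter_upwards [Ioi_mem_nhds ht] with u hu using hR u hu
      rw [this.deriv_eq, deriv_const]
    obtain ⟨N, c, h⟩ := ih hd hR' hε
    have hE : ∀ t, HasDerivAt (fun t => expSum N (fun k => -c k / (k + 1)) t - ψ t)
        (expSum N c t - deriv ψ t) t := fun t =>
      (hasDerivAt_expSum_primitive N c t).sub
        ((contDiff_infty_iff_deriv.1 hψ).1 t).hasDerivAt
    have hE' : deriv (fun t => expSum N (fun k => -c k / (k + 1)) t - ψ t) =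
        fun t => expSum N c t - deriv ψ t := funext fun t => (hE t).deriv
    refine ⟨N, fun k => -c k / (k + 1), fun j hj t ht => ?_⟩
    rcases j with _ | j
    · rw [iteratedDeriv_zero]
      refine norm_le_of_deriv_le_exp hE ((contDiff_expSum N c).continuous.sub hd.continuous) ?_
        (fun t ht => by simpa using h 0 (Nat.zero_le _) t ht) ht
      have h0 : Filter.Tendsto ψ Filter.atTop (𝓝 0) :=
        tendsto_const_nhds.congr' (by
          filter_upwards [Filter.eventually_gt_atTop R] with t ht using (hR t ht).symm)
      simpa using (tendsto_expSum N _).sub h0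
    · rw [iteratedDeriv_succ', hE']
      exact h j (by omega) t ht

theorem smulLeftCLM_cutoff_apply (ψ : 𝓢(ℝ, ℂ)) (t : ℝ) :
    SchwartzMap.smulLeftCLM ℂ cutoff ψ t = cutoff t * ψ t := by
  rw [SchwartzMap.smulLeftCLM_apply_apply hasTemperateGrowth_cutoff, smul_eq_mul]

/-- If the Laplace transform vanishes at the positive integers, then `y` vanishes on test functions
that vanish near `+∞`, since exponential polynomials approximate them near the support of `y`. -/
theorem apply_eq_zero_of_laplace_nat (y : TemperedPlus)
    (hy : ∀ (k : ℕ) (hk : 0 < ((k : ℂ) + 1).re), laplace y ((k : ℂ) + 1) hk = 0)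
    (ψ : 𝓢(ℝ, ℂ)) {R : ℝ} (hR : ∀ t, R < t → ψ t = 0) : y.1 ψ = 0 := by
  have hpos : ∀ k : ℕ, 0 < ((k : ℂ) + 1).re := fun k => by
    simp only [Complex.add_re, Complex.natCast_re, Complex.one_re]; positivity
  obtain ⟨m, C, hC, hL⟩ := clm_bound (toDual y.1)
  choose K hK0 hK using cutoff_mul_bound
  choose D hD0 hD using fun k => exp_decay (s := 1) (by simp) k
  have key : ∀ ε : ℝ, 0 < ε → ‖y.1 ψ‖ ≤ (C * ∑ p ∈ Finset.Iic m, K p.2 * D p.1) * ε := by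
    intro ε hε
    obtain ⟨N, c, h⟩ := exists_expSum_near_iteratedDeriv m.2 (ψ.smooth ⊤) hR hε
    set Θ : 𝓢(ℝ, ℂ) := ∑ k ∈ Finset.range N, c k • laplaceTest ((k : ℂ) + 1) (hpos k)
      - SchwartzMap.smulLeftCLM ℂ cutoff ψ with hΘ
    have e1 : y.1 Θ = -y.1 ψ := by
      have e2 : y.1 (SchwartzMap.smulLeftCLM ℂ cutoff ψ) = y.1 ψ :=
        apply_eq_of_eqOn_Ioi y one_pos fun t ht => by
          rw [smulLeftCLM_cutoff_apply, cutoff_of_ge ht.le, one_mul]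
      have e3 : y.1 (∑ k ∈ Finset.range N, c k • laplaceTest ((k : ℂ) + 1) (hpos k)) = 0 := by
        rw [map_sum]
        refine Finset.sum_eq_zero fun k _ => ?_
        rw [map_smul]
        exact (congrArg (c k • ·) (hy k (hpos k))).trans (smul_zero _)
      rw [hΘ, map_sub, e2, e3, zero_sub]
    have e4 : ⇑Θ = fun t => cutoff t * (expSum N c t - ψ t) := by
      ext t
      simp only [hΘ, sub_apply, sum_apply, smul_apply,
        smulLeftCLM_cutoff_apply, laplaceTest_apply, expSum, mul_sub, Finset.mul_sum, smul_eq_mul]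
      congr 1
      exact Finset.sum_congr rfl fun k _ => mul_left_comm _ _ _
    rw [← norm_neg, ← e1, mul_assoc, Finset.sum_mul]
    refine (hL Θ).trans (mul_le_mul_of_nonneg_left (Finset.sum_le_sum fun p hp => ?_) hC)
    refine SchwartzMap.seminorm_le_bound ℂ _ _ _
      (mul_nonneg (mul_nonneg (hK0 _) (hD0 _)) hε.le) fun t => ?_
    rw [e4, mul_assoc]
    refine hK _ _ ((contDiff_expSum N c).sub (ψ.smooth ⊤)) _ _ t (by positivity)
      (mul_nonneg (hD0 _) hε.le) fun ht j hj => ?_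
    rw [norm_iteratedFDeriv_eq_norm_iteratedDeriv]
    have h1 := h j (hj.trans (Finset.mem_Iic.1 hp).2) t ht
    have h2 := hD p.1 t ht
    rw [Complex.one_re, one_mul] at h2
    calc ‖t‖ ^ p.1 * _ ≤ ‖t‖ ^ p.1 * (ε * Real.exp (-t)) := by gcongr
      _ = (|t| ^ p.1 * Real.exp (-t)) * ε := by rw [Real.norm_eq_abs]; ring
      _ ≤ D p.1 * ε := by gcongr
  have hl : Filter.Tendsto (fun ε : ℝ => (C * ∑ p ∈ Finset.Iic m, K p.2 * D p.1) * ε)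
      (𝓝[>] 0) (𝓝 0) := by
    have h : Filter.Tendsto (fun ε : ℝ => (C * ∑ p ∈ Finset.Iic m, K p.2 * D p.1) * ε)
      (𝓝 0) (𝓝 ((C * ∑ p ∈ Finset.Iic m, K p.2 * D p.1) * 0)) := Filter.tendsto_id.const_mul _
    rw [mul_zero] at h
    exact h.mono_left nhdsWithin_le_nhds
  exact norm_le_zero_iff.1 (ge_of_tendsto hl (by
    filter_upwards [self_mem_nhdsWithin] with ε hε using key ε hε))

/-- The part `χ(t - R) ψ(t)` of a Schwartz function `ψ` near `+∞`. -/
noncomputable def tail (R : ℝ) (ψ : 𝓢(ℝ, ℂ)) : 𝓢(ℝ, ℂ) :=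
  shift (-R) (SchwartzMap.smulLeftCLM ℂ cutoff (shift R ψ))

theorem tail_apply_of_ge {R : ℝ} (ψ : 𝓢(ℝ, ℂ)) {t : ℝ} (ht : R ≤ t) : tail R ψ t = ψ t := by
  rw [tail, shift_apply, smulLeftCLM_cutoff_apply, shift_apply, cutoff_of_ge (by linarith), one_mul]
  congr 1
  ring

/-- Quantitative form of `tail R ψ → 0` in `𝓢` as `R → ∞`; since `ψ - tail R ψ` vanishes beyond `R`,
the functions vanishing near `+∞` are dense in `𝓢`. -/
theorem seminorm_tail_le (ψ : 𝓢(ℝ, ℂ)) (k n : ℕ) : ∃ C : ℝ, 0 ≤ C ∧ ∀ R : ℝ, 2 < R →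
    SchwartzMap.seminorm ℂ k n (tail R ψ) ≤ C * (R - 2)⁻¹ := by
  obtain ⟨K, hK0, hK⟩ := cutoff_mul_bound n
  set S := ∑ j ∈ Finset.range (n + 1), SchwartzMap.seminorm ℂ (k + 1) j ψ with hS
  have hS0 : 0 ≤ S := Finset.sum_nonneg fun _ _ => apply_nonneg _ _
  refine ⟨K * S, mul_nonneg hK0 hS0, fun R hR => ?_⟩
  have hR' : 0 < R - 2 := by linarith
  refine SchwartzMap.seminorm_le_bound' ℂ k n _ (by positivity) fun t => ?_
  have e : ⇑(SchwartzMap.smulLeftCLM ℂ cutoff (shift R ψ)) =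
      fun t => cutoff t * shift R ψ t := funext (smulLeftCLM_cutoff_apply _)
  rw [tail, iteratedDeriv_shift, e, ← norm_iteratedFDeriv_eq_norm_iteratedDeriv, mul_assoc]
  refine hK _ ((shift R ψ).smooth ⊤) _ _ _ (by positivity) (by positivity) fun ht j hj => ?_
  rw [norm_iteratedFDeriv_eq_norm_iteratedDeriv, iteratedDeriv_shift, ← div_eq_mul_inv,
    le_div_iff₀ hR', show R + (-R + t) = t by ring]
  have ht' : R - 2 ≤ |t| := le_trans (by linarith) (le_abs_self t)
  calc |t| ^ k * ‖iteratedDeriv j ψ t‖ * (R - 2)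
      ≤ |t| ^ k * ‖iteratedDeriv j ψ t‖ * |t| := by gcongr
    _ = |t| ^ (k + 1) * ‖iteratedDeriv j ψ t‖ := by ring
    _ ≤ SchwartzMap.seminorm ℂ (k + 1) j ψ := SchwartzMap.le_seminorm' ℂ (k + 1) j ψ t
    _ ≤ S := Finset.single_le_sum (f := fun j => SchwartzMap.seminorm ℂ (k + 1) j ψ)
      (fun _ _ => apply_nonneg _ _) (Finset.mem_range.2 (by omega))

/-- The Laplace transform on `S'_+` is injective; its values at the positive integers suffice. -/
theorem eq_zero_of_laplace_nat (y : TemperedPlus)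
    (hy : ∀ (k : ℕ) (hk : 0 < ((k : ℂ) + 1).re), laplace y ((k : ℂ) + 1) hk = 0) : y = 0 := by
  refine Subtype.ext (DFunLike.ext _ _ fun ψ => ?_)
  change y.1 ψ = 0
  obtain ⟨m, C, hC, hL⟩ := clm_bound (toDual y.1)
  choose B hB0 hB using seminorm_tail_le ψ
  have key : ∀ R : ℝ, 2 < R → ‖y.1 ψ‖ ≤ (C * ∑ p ∈ Finset.Iic m, B p.1 p.2) * (R - 2)⁻¹ := by
    intro R hR
    have e : y.1 ψ = y.1 (tail R ψ) := by
      have h := apply_eq_zero_of_laplace_nat y hy (ψ - tail R ψ) (R := R) fun t ht => by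
        rw [sub_apply, tail_apply_of_ge ψ ht.le, sub_self]
      rwa [map_sub, sub_eq_zero] at h
    rw [e, mul_assoc, Finset.sum_mul]
    exact (hL _).trans (mul_le_mul_of_nonneg_left (Finset.sum_le_sum fun p _ => hB _ _ R hR) hC)
  have hl : Filter.Tendsto (fun R : ℝ => (C * ∑ p ∈ Finset.Iic m, B p.1 p.2) * (R - 2)⁻¹)
      Filter.atTop (𝓝 0) := by
    have h := (tendsto_inv_atTop_zero.comp
      (Filter.tendsto_atTop_add_const_right Filter.atTop (-2 : ℝ) Filter.tendsto_id)).const_mul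
        (C * ∑ p ∈ Finset.Iic m, B p.1 p.2)
    rw [mul_zero] at h
    exact h
  exact norm_le_zero_iff.1 (ge_of_tendsto hl (by
    filter_upwards [Filter.eventually_gt_atTop 2] with R hR using key R hR))

theorem laplace_sub (y z : TemperedPlus) (s : ℂ) (hs : 0 < s.re) :
    laplace (y - z) s hs = laplace y s hs - laplace z s hs := rfl

/-- Both convolutions have the Laplace transform `f̂ ĝ`. -/
theorem conv_comm (f g : TemperedPlus) : conv f g = conv g f := by
  rw [← sub_eq_zero]
  refine eq_zero_of_laplace_nat _ fun k hk => ?_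
  rw [laplace_sub, laplace_conv, laplace_conv, mul_comm, sub_self]

end DistOrder

/-! ### The family `f_α` -/

namespace DistOrder

theorem derivPlus_apply (y : TemperedPlus) (ψ : 𝓢(ℝ, ℂ)) :
    (derivPlus y).1 ψ = -y.1 (SchwartzMap.derivCLM ℂ ℂ ψ) := by
  change TemperedDistribution.derivCLM ℂ y.1 ψ = _
  rw [TemperedDistribution.derivCLM_apply_apply, map_neg]

theorem iterate_derivPlus_apply (n : ℕ) (y : TemperedPlus) (ψ : 𝓢(ℝ, ℂ)) :
    (derivPlus^[n] y).1 ψ = (-1) ^ n * y.1 ((SchwartzMap.derivCLM ℂ ℂ)^[n] ψ) := by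
  induction n generalizing ψ with
  | zero => simp
  | succ n ih =>
    rw [Function.iterate_succ_apply', derivPlus_apply, ih, Function.iterate_succ_apply]
    ring

/-- `f_(α+1)' = f_α`, by integration by parts and `Γ(α + 1) = α Γ(α)`. -/
theorem derivPlus_powerPos (α : ℝ) (hα : 0 < α) (hα' : 0 < α + 1) :
    derivPlus (powerPos (α + 1) hα') = powerPos α hα := by
  refine Subtype.ext (DFunLike.ext _ _ fun ψ => ?_)
  rw [derivPlus_apply, powerPos_apply, powerPos_apply]
  have hu : ∀ x ∈ Ioi (0 : ℝ), HasDerivAt (fun x : ℝ => ((x ^ α : ℝ) : ℂ))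
      ((α * x ^ (α - 1) : ℝ) : ℂ) x := fun x hx =>
    (Real.hasDerivAt_rpow_const (Or.inl (ne_of_gt hx))).ofReal_comp
  have hv : ∀ x ∈ Ioi (0 : ℝ), HasDerivAt ψ (SchwartzMap.derivCLM ℂ ℂ ψ x) x := fun x _ =>
    ψ.differentiableAt.hasDerivAt
  have h1 := rpow_mul_integrable hα' (SchwartzMap.derivCLM ℂ ℂ ψ)
  have h2 := (rpow_mul_integrable hα ψ).const_mul (α : ℂ)
  simp only [add_sub_cancel_right] at h1 ⊢
  have e : ∀ x : ℝ, (α : ℂ) * (((x ^ (α - 1) : ℝ) : ℂ) * ψ x) =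
      ((α * x ^ (α - 1) : ℝ) : ℂ) * ψ x := fun x => by push_cast; ring
  simp only [e] at h2
  have hz : Filter.Tendsto ((fun x : ℝ => ((x ^ α : ℝ) : ℂ)) * ⇑ψ) (𝓝[>] 0) (𝓝 0) := by
    have hc : Continuous ((fun x : ℝ => ((x ^ α : ℝ) : ℂ)) * ⇑ψ) :=
      (Complex.continuous_ofReal.comp (Real.continuous_rpow_const hα.le)).mul ψ.continuous
    have h := hc.tendsto 0
    simp only [Pi.mul_apply, Real.zero_rpow hα.ne', Complex.ofReal_zero, zero_mul] at h
    exact h.mono_left nhdsWithin_le_nhds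
  have hi : Filter.Tendsto ((fun x : ℝ => ((x ^ α : ℝ) : ℂ)) * ⇑ψ) Filter.atTop (𝓝 0) := by
    obtain ⟨N, hN⟩ := exists_nat_gt (α + 1)
    set S := SchwartzMap.seminorm ℂ N 0 ψ
    have hlim : Filter.Tendsto (fun x : ℝ => S * x⁻¹) Filter.atTop (𝓝 0) := by
      simpa using tendsto_inv_atTop_zero.const_mul S
    refine squeeze_zero_norm' ?_ hlim
    filter_upwards [Filter.eventually_ge_atTop 1] with x hx
    have hx0 : 0 < x := by linarith
    rw [Pi.mul_apply, norm_mul, Complex.norm_real, Real.norm_of_nonneg (by positivity),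
      ← div_eq_mul_inv, le_div_iff₀ hx0]
    have h3 := SchwartzMap.norm_pow_mul_le_seminorm ℂ ψ N x
    rw [Real.norm_of_nonneg hx0.le] at h3
    refine le_trans ?_ h3
    calc x ^ α * ‖ψ x‖ * x = x ^ (α + 1) * ‖ψ x‖ := by
          rw [Real.rpow_add hx0, Real.rpow_one]; ring
      _ ≤ x ^ (N : ℝ) * ‖ψ x‖ := by gcongr
      _ = x ^ N * ‖ψ x‖ := by rw [Real.rpow_natCast]
  have key := integral_Ioi_mul_deriv_eq_deriv_mul hu hv h1 h2 hz hi
  rw [key, ← integral_congr_ae (.of_forall e), integral_const_mul, Real.Gamma_add_one hα.ne']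
  have hα0 : (α : ℂ) ≠ 0 := by exact_mod_cast hα.ne'
  have hG : (Real.Gamma α : ℂ) ≠ 0 := by exact_mod_cast (Real.Gamma_pos_of_pos hα).ne'
  push_cast
  field_simp
  ring

theorem powerPos_congr {α β : ℝ} (h : α = β) (hα : 0 < α) (hβ : 0 < β) :
    powerPos α hα = powerPos β hβ := by
  subst h
  rfl

theorem iterate_derivPlus_powerPos (k : ℕ) (α : ℝ) (hα : 0 < α) (hα' : 0 < α + k) :
    derivPlus^[k] (powerPos (α + k) hα') = powerPos α hα := by
  induction k with
  | zero => exact powerPos_congr (by simp) _ _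
  | succ k ih =>
    have h : 0 < α + k := by positivity
    rw [Function.iterate_succ_apply, ← ih h]
    congr 1
    rw [← derivPlus_powerPos _ h (by positivity)]
    congr 1
    exact powerPos_congr (by push_cast; ring) _ _

/-- In the definition of `f_α` any `N` with `α + N > 0` may be used. -/
theorem power_eq_iterate (α : ℝ) (N : ℕ) (hN : 0 < α + N) :
    power α = derivPlus^[N] (powerPos (α + N) hN) := by
  by_cases hα : 0 < α
  · rw [iterate_derivPlus_powerPos N α hα, power, dif_pos hα]
  · have h0 : (0 : ℝ) ≤ -α := by linarith
    have hle : ⌊-α⌋₊ + 1 ≤ N := by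
      rw [Nat.add_one_le_iff, Nat.floor_lt h0]
      linarith
    obtain ⟨k, rfl⟩ := Nat.exists_eq_add_of_le hle
    have h1 : 0 < α + (⌊-α⌋₊ + 1 : ℕ) := by
      have := Nat.lt_floor_add_one (-α)
      push_cast
      linarith
    rw [power, dif_neg hα, Function.iterate_add_apply derivPlus (⌊-α⌋₊ + 1) k,
      ← iterate_derivPlus_powerPos k _ h1 (by positivity)]
    exact congrArg (fun y => derivPlus^[⌊-α⌋₊ + 1] (derivPlus^[k] y))
      (powerPos_congr (by push_cast; ring) _ _)

theorem powerPos_apply_eq_mellin (α : ℝ) (hα : 0 < α) (ψ : 𝓢(ℝ, ℂ)) :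
    (powerPos α hα).1 ψ = (Complex.Gamma α)⁻¹ * mellin ψ α := by
  rw [powerPos_apply, Complex.Gamma_ofReal, mellin]
  congr 1
  refine setIntegral_congr_fun measurableSet_Ioi fun x hx => ?_
  rw [Complex.ofReal_cpow (le_of_lt hx), smul_eq_mul]
  push_cast
  rfl

theorem differentiableAt_mellin (ψ : 𝓢(ℝ, ℂ)) {z : ℂ} (hz : 0 < z.re) :
    DifferentiableAt ℂ (mellin ψ) z := by
  refine mellin_differentiableAt_of_isBigO_rpow (a := z.re + 1) (b := 0)
    (ψ.continuous.locallyIntegrable.locallyIntegrableOn _) ?_ (by linarith) ?_ hz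
  · refine ((ψ.isBigO_cocompact_rpow (-(z.re + 1))).mono
      atTop_le_cocompact).congr' .rfl ?_
    filter_upwards [Filter.eventually_ge_atTop 0] with x hx
    rw [Real.norm_of_nonneg hx]
  · simp only [neg_zero, Real.rpow_zero]
    exact Asymptotics.IsBigO.of_bound (SchwartzMap.seminorm ℂ 0 0 ψ)
      (.of_forall fun x => by simpa using SchwartzMap.norm_le_seminorm ℂ ψ x)

theorem integrable_one_add_abs_inv_sq : Integrable fun x : ℝ => ((1 + |x|) ^ 2)⁻¹ := by
  have h := integrable_one_add_norm (E := ℝ) (μ := volume) (r := 2) (by simp)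
  refine h.congr (.of_forall fun x => ?_)
  change (1 + |x|) ^ (-2 : ℝ) = _
  rw [Real.rpow_neg (by positivity)]
  norm_num

/-- Bound for the Mellin transform of `ψ^(n)` on the strip `1 ≤ Re z ≤ M`. -/
theorem norm_mellin_le (M n : ℕ) : ∃ C : ℝ, 0 ≤ C ∧ ∀ (ψ : 𝓢(ℝ, ℂ)) (z : ℂ), 1 ≤ z.re →
    z.re ≤ M → ‖mellin ((SchwartzMap.derivCLM ℂ ℂ)^[n] ψ) z‖ ≤
      C * (Finset.Iic (M + 2, n)).sup (schwartzSeminormFamily ℂ ℝ ℂ) ψ := by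
  refine ⟨2 ^ (M + 2) * ∫ x in Ioi (0 : ℝ), ((1 + |x|) ^ 2)⁻¹,
    mul_nonneg (by positivity) (integral_nonneg fun x => by positivity), fun ψ z h1 h2 => ?_⟩
  set S := (Finset.Iic (M + 2, n)).sup (schwartzSeminormFamily ℂ ℝ ℂ) ψ with hS
  rw [mul_right_comm, ← integral_const_mul]
  refine norm_integral_le_of_norm_le (integrable_one_add_abs_inv_sq.integrableOn.const_mul _)
    ((ae_restrict_iff' measurableSet_Ioi).2 (.of_forall fun x hx => ?_))
  have hx0 : (0 : ℝ) < x := hx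
  rw [iterate_derivCLM, norm_smul, Complex.norm_cpow_eq_rpow_re_of_pos hx0, ← div_eq_mul_inv,
    le_div_iff₀ (by positivity), Complex.sub_re, Complex.one_re]
  refine le_trans ?_ (one_add_pow_le ψ (M + 2) n x)
  have h3 : x ^ (z.re - 1) ≤ (1 + |x|) ^ M := by
    rw [abs_of_pos hx0, ← Real.rpow_natCast]
    calc x ^ (z.re - 1) ≤ (1 + x) ^ (z.re - 1) :=
          Real.rpow_le_rpow hx0.le (by linarith) (by linarith)
      _ ≤ (1 + x) ^ (M : ℝ) := Real.rpow_le_rpow_of_exponent_le (by linarith) (by linarith)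
  calc x ^ (z.re - 1) * ‖iteratedDeriv n ψ x‖ * (1 + |x|) ^ 2
      ≤ (1 + |x|) ^ M * ‖iteratedDeriv n ψ x‖ * (1 + |x|) ^ 2 := by gcongr
    _ = (1 + |x|) ^ (M + 2) * ‖iteratedDeriv n ψ x‖ := by ring

/-- On every disc, `γ ↦ ⟨f_(-γ), ψ⟩` extends holomorphically, with a bound by a Schwartz seminorm
of `ψ`: for large `N` the extension is the Mellin transform of `ψ^(N)` at `N - z`, divided by
`Γ(N - z)`. -/
theorem exists_holomorphic_extension_power (r : ℝ) :
    ∃ (s : Finset (ℕ × ℕ)) (C : ℝ), 0 ≤ C ∧ ∀ ψ : 𝓢(ℝ, ℂ), ∃ F : ℂ → ℂ,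
      DifferentiableOn ℂ F (Metric.ball 0 r) ∧
      (∀ z ∈ Metric.ball (0 : ℂ) r, ‖F z‖ ≤ C * s.sup (schwartzSeminormFamily ℂ ℝ ℂ) ψ) ∧
      ∀ γ : ℝ, |γ| < r → (power (-γ)).1 ψ = F γ := by
  -- with `N > r + 1` the points `N - z`, `|z| ≤ r`, lie in the strip `1 ≤ Re ≤ 2N`
  obtain ⟨N, hN⟩ := exists_nat_gt (r + 1)
  have hre : ∀ z ∈ Metric.closedBall (0 : ℂ) r, 1 ≤ (N - z).re ∧ (N - z).re ≤ (2 * N : ℕ) := by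
    intro z hz
    have h1 : |z.re| ≤ r := (Complex.abs_re_le_norm z).trans (mem_closedBall_zero_iff.1 hz)
    have h2 := abs_le.1 h1
    rw [Complex.sub_re, Complex.natCast_re]
    push_cast
    constructor <;> linarith
  obtain ⟨C, hC0, hC⟩ := norm_mellin_le (2 * N) N
  have hGd : Differentiable ℂ fun z : ℂ => (Complex.Gamma (N - z))⁻¹ :=
    Complex.differentiable_one_div_Gamma.comp ((differentiable_const _).sub differentiable_id)
  obtain ⟨B, hB⟩ := (isCompact_closedBall (0 : ℂ) r).exists_bound_of_continuousOn
    hGd.continuous.continuousOn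
  refine ⟨Finset.Iic (2 * N + 2, N), max B 0 * C, by positivity, fun ψ =>
    ⟨fun z => (-1) ^ N * ((Complex.Gamma (N - z))⁻¹ *
      mellin ((SchwartzMap.derivCLM ℂ ℂ)^[N] ψ) (N - z)), ?_, fun z hz => ?_, fun γ hγ => ?_⟩⟩
  · intro z hz
    have h1 := (hre z (Metric.ball_subset_closedBall hz)).1
    have h2 : DifferentiableAt ℂ (fun z : ℂ =>
        mellin ((SchwartzMap.derivCLM ℂ ℂ)^[N] ψ) (N - z)) z :=
      (differentiableAt_mellin _ (z := N - z) (by linarith)).comp z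
        ((differentiableAt_const _).sub differentiableAt_id)
    exact (((hGd z).mul h2).const_mul _).differentiableWithinAt
  · have hz' := Metric.ball_subset_closedBall hz
    rw [norm_mul, norm_pow, norm_neg, norm_one, one_pow, one_mul, norm_mul, mul_assoc]
    exact mul_le_mul ((hB z hz').trans (le_max_left _ _)) (hC ψ _ (hre z hz').1 (hre z hz').2)
      (norm_nonneg _) (by positivity)
  · have h1 := abs_lt.1 hγ
    have h2 : 0 < -γ + N := by linarith
    rw [power_eq_iterate _ N h2, iterate_derivPlus_apply, powerPos_apply_eq_mellin]
    congr 3 <;> · push_cast; ring_nf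

end DistOrder

/-! ### Smooth dependence on the order -/

namespace DistOrder

/-- Restricted to the real axis, a holomorphic function is smooth and its real derivatives are the
complex ones. -/
theorem contDiffAt_and_iteratedDeriv_of_holomorphic {F : ℂ → ℂ} {r : ℝ}
    (hF : DifferentiableOn ℂ F (Metric.ball 0 r)) {g : ℝ → ℂ} (hg : ∀ γ : ℝ, |γ| < r → g γ = F γ)
    {γ : ℝ} (hγ : |γ| < r) :
    ContDiffAt ℝ ∞ g γ ∧ ∀ j, iteratedDeriv j g γ = iteratedDeriv j F γ := by
  have hmem : ∀ x : ℝ, |x| < r → (x : ℂ) ∈ Metric.ball (0 : ℂ) r := fun x hx => by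
    simpa using hx
  have hA : ∀ x : ℝ, |x| < r → AnalyticAt ℂ F x := fun x hx =>
    hF.analyticAt (Metric.isOpen_ball.mem_nhds (hmem x hx))
  have hnhds : ∀ x : ℝ, |x| < r → ∀ᶠ u in 𝓝 x, |u| < r := fun x hx =>
    continuous_abs.continuousAt.eventually (gt_mem_nhds hx)
  constructor
  · have h1 : ContDiffAt ℝ ∞ (fun x : ℝ => F x) γ :=
      ((hA γ hγ).contDiffAt.restrict_scalars ℝ).comp γ Complex.ofRealCLM.contDiff.contDiffAt
    exact h1.congr_of_eventuallyEq (by filter_upwards [hnhds γ hγ] with u hu using hg u hu)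
  · intro j
    induction j generalizing γ with
    | zero => simpa using hg γ hγ
    | succ j ih =>
      have h1 : iteratedDeriv j g =ᶠ[𝓝 γ] fun x : ℝ => iteratedDeriv j F x := by
        filter_upwards [hnhds γ hγ] with u hu using ih hu
      have h2 : HasDerivAt (iteratedDeriv j F) (iteratedDeriv (j + 1) F γ) (γ : ℂ) := by
        rw [iteratedDeriv_succ, iteratedDeriv_eq_iterate]
        exact ((hA γ hγ).iterated_deriv j).differentiableAt.hasDerivAt
      rw [iteratedDeriv_succ, h1.deriv_eq, h2.comp_ofReal.deriv]

theorem contDiff_power_apply (ψ : 𝓢(ℝ, ℂ)) : ContDiff ℝ ∞ fun γ : ℝ => (power (-γ)).1 ψ := by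
  refine contDiff_iff_contDiffAt.2 fun γ => ?_
  obtain ⟨s, C, -, h⟩ := exists_holomorphic_extension_power (|γ| + 1)
  obtain ⟨F, hF, -, hg⟩ := h ψ
  exact (contDiffAt_and_iteratedDeriv_of_holomorphic hF hg (by linarith)).1

/-- Cauchy's estimate for the derivatives of `γ ↦ ⟨f_(-γ), ψ⟩`. -/
theorem norm_iteratedDeriv_power_le (r : ℝ) (j : ℕ) :
    ∃ (s : Finset (ℕ × ℕ)) (C : ℝ), 0 ≤ C ∧ ∀ (ψ : 𝓢(ℝ, ℂ)) (γ : ℝ), |γ| ≤ r →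
      ‖iteratedDeriv j (fun γ : ℝ => (power (-γ)).1 ψ) γ‖ ≤
        C * s.sup (schwartzSeminormFamily ℂ ℝ ℂ) ψ := by
  -- circles of radius `1` about `γ ∈ [-r, r]` lie in the disc of radius `r + 2`
  obtain ⟨s, C, hC0, h⟩ := exists_holomorphic_extension_power (r + 2)
  refine ⟨s, j.factorial * C, by positivity, fun ψ γ hγ => ?_⟩
  obtain ⟨F, hF, hb, hg⟩ := h ψ
  rw [(contDiffAt_and_iteratedDeriv_of_holomorphic hF hg (by linarith)).2 j]
  have hsub : Metric.closedBall (γ : ℂ) 1 ⊆ Metric.ball 0 (r + 2) := by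
    refine Metric.closedBall_subset_ball' ?_
    rw [dist_zero_right, Complex.norm_real, Real.norm_eq_abs]
    linarith
  have hd : DiffContOnCl ℂ F (Metric.ball (γ : ℂ) 1) := by
    refine DifferentiableOn.diffContOnCl (hF.mono ?_)
    rwa [closure_ball _ one_ne_zero]
  have := Complex.norm_iteratedDeriv_le_of_forall_mem_sphere_norm_le j one_pos hd
    (fun z hz => hb z (hsub (Metric.sphere_subset_closedBall hz)))
  rwa [one_pow, div_one, ← mul_assoc] at this

/-- The continuous linear map `ψ ↦ (γ ↦ ⟨f_(-γ), ψ⟩)` from `𝓢` to `E(ℝ)`. -/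
noncomputable def powerFamily : 𝓢(ℝ, ℂ) →L[ℂ] SmoothFun where
  toFun ψ := ⟨fun γ : ℝ => (power (-γ)).1 ψ, contDiff_power_apply ψ⟩
  map_add' ψ θ := Subtype.ext (funext fun γ => map_add (power (-γ)).1 ψ θ)
  map_smul' a ψ := Subtype.ext (funext fun γ => map_smul (power (-γ)).1 a ψ)
  cont := by
    refine continuous_iInf_rng.2 fun j => continuous_induced_rng.2 ?_
    refine continuous_iff_continuousAt.2 fun ψ₀ => ?_
    refine ContinuousMap.tendsto_iff_forall_isCompact_tendstoUniformlyOn.2 fun K hK => ?_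
    obtain ⟨r, hr⟩ := hK.isBounded.subset_closedBall 0
    obtain ⟨s, C, hC0, h⟩ := norm_iteratedDeriv_power_le r j
    refine Metric.tendstoUniformlyOn_iff.2 fun ε hε => ?_
    filter_upwards [((schwartz_withSeminorms ℂ ℝ ℂ).tendsto_nhds' id ψ₀).1 Filter.tendsto_id s
      (ε / (C + 1)) (by positivity)] with ψ hψ γ hγ
    have hγ' : |γ| ≤ r := by simpa using hr hγ
    have hlt : C * s.sup (schwartzSeminormFamily ℂ ℝ ℂ) (ψ - ψ₀) < ε := by
      rw [id, lt_div_iff₀ (by positivity)] at hψ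
      have := apply_nonneg (s.sup (schwartzSeminormFamily ℂ ℝ ℂ)) (ψ - ψ₀)
      linarith
    refine lt_of_le_of_lt ?_ hlt
    rw [dist_comm]
    refine le_trans (le_of_eq ?_) (h (ψ - ψ₀) γ hγ')
    have e : (fun γ : ℝ => (power (-γ)).1 (ψ - ψ₀)) =
        (fun γ : ℝ => (power (-γ)).1 ψ) - fun γ : ℝ => (power (-γ)).1 ψ₀ :=
      funext fun γ => map_sub (power (-γ)).1 ψ ψ₀
    have hcd : ∀ ψ : 𝓢(ℝ, ℂ), ContDiffAt ℝ j (fun γ : ℝ => (power (-γ)).1 ψ) γ := fun ψ =>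
      ((contDiff_power_apply ψ).of_le (by exact_mod_cast le_top)).contDiffAt
    rw [e, iteratedDeriv_sub (hcd _) (hcd _), dist_eq_norm]
    rfl

end DistOrder

/-! ### The Laplace transform of `f_α` -/

namespace DistOrder

theorem laplace_derivPlus (y : TemperedPlus) (s : ℂ) (hs : 0 < s.re) :
    laplace (derivPlus y) s hs = s * laplace y s hs := by
  rw [laplace, derivPlus_apply, apply_eq_mul_laplace y hs (-s) one_pos, neg_mul, neg_neg]
  intro t ht
  have h : laplaceTest s hs =ᶠ[𝓝 t] fun t : ℝ => Complex.exp (-(s * t)) := by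
    filter_upwards [Ioi_mem_nhds ht] with u hu
    rw [laplaceTest_apply, cutoff_of_ge (le_of_lt hu), one_mul]
  change deriv (laplaceTest s hs) t = _
  have h1 := congrFun (iteratedDeriv_exp_neg s 1) t
  rw [iteratedDeriv_one, pow_one] at h1
  rw [h.deriv_eq, h1]

theorem laplace_powerPos_eq_integral (α : ℝ) (hα : 0 < α) (s : ℂ) (hs : 0 < s.re) :
    laplace (powerPos α hα) s hs = (Real.Gamma α : ℂ)⁻¹ *
      ∫ x in Ioi (0 : ℝ), ((x ^ (α - 1) : ℝ) : ℂ) * Complex.exp (-(s * x)) := by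
  rw [laplace, powerPos_apply]
  congr 1
  refine setIntegral_congr_fun measurableSet_Ioi fun x hx => ?_
  have hx0 : (0 : ℝ) < x := hx
  simp only [laplaceTest_apply]
  rw [cutoff_of_ge (by linarith), one_mul]

theorem aestronglyMeasurable_rpow_mul_exp (α : ℝ) (s : ℂ) (μ : Measure ℝ) :
    AEStronglyMeasurable (fun x : ℝ => ((x ^ (α - 1) : ℝ) : ℂ) * Complex.exp (-(s * x))) μ :=
  (Complex.measurable_ofReal.comp (measurable_id.pow_const (α - 1))).aestronglyMeasurable.mul
    (contDiff_exp_neg s).continuous.aestronglyMeasurable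

theorem norm_rpow_mul_exp (α : ℝ) (s : ℂ) {x : ℝ} (hx : 0 < x) :
    ‖((x ^ (α - 1) : ℝ) : ℂ) * Complex.exp (-(s * x))‖ =
      x ^ (α - 1) * Real.exp (-(s.re * x)) := by
  rw [norm_mul, Complex.norm_real, Real.norm_of_nonneg (by positivity), Complex.norm_exp]
  simp

theorem integrableOn_rpow_mul_exp_neg {α b : ℝ} (hα : 0 < α) (hb : 0 < b) :
    IntegrableOn (fun x : ℝ => x ^ (α - 1) * Real.exp (-(b * x))) (Ioi 0) := by
  simpa only [neg_mul, Real.rpow_one] using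
    integrableOn_rpow_mul_exp_neg_mul_rpow (s := α - 1) (by linarith) one_pos hb

theorem hasDerivAt_integral_rpow_mul_exp (α : ℝ) (hα : 0 < α) {s : ℂ} (hs : 0 < s.re) :
    HasDerivAt (fun s : ℂ => ∫ x in Ioi (0 : ℝ),
        ((x ^ (α - 1) : ℝ) : ℂ) * Complex.exp (-(s * x)))
      (-∫ x in Ioi (0 : ℝ), ((x ^ (α + 1 - 1) : ℝ) : ℂ) * Complex.exp (-(s * x))) s := by
  have hb : 0 < s.re / 2 := by positivity
  have hI : ∀ β : ℝ, 0 < β → IntegrableOn (fun x : ℝ =>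
      ((x ^ (β - 1) : ℝ) : ℂ) * Complex.exp (-(s * x))) (Ioi 0) := fun β hβ =>
    (integrableOn_rpow_mul_exp_neg hβ hs).mono' (aestronglyMeasurable_rpow_mul_exp _ _ _)
      ((ae_restrict_iff' measurableSet_Ioi).2 (.of_forall fun x hx =>
        (norm_rpow_mul_exp β s hx).le))
  rw [← integral_neg]
  refine (hasDerivAt_integral_of_dominated_loc_of_deriv_le
    (F := fun (s : ℂ) (x : ℝ) => ((x ^ (α - 1) : ℝ) : ℂ) * Complex.exp (-(s * x)))
    (F' := fun (s : ℂ) (x : ℝ) => -(((x ^ (α + 1 - 1) : ℝ) : ℂ) * Complex.exp (-(s * x))))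
    (bound := fun x => x ^ (α + 1 - 1) * Real.exp (-(s.re / 2 * x)))
    (Metric.ball_mem_nhds s hb) (.of_forall fun z => aestronglyMeasurable_rpow_mul_exp _ _ _)
    (hI α hα) (aestronglyMeasurable_rpow_mul_exp _ _ _).neg ?_
    (integrableOn_rpow_mul_exp_neg (by positivity) hb) ?_).2
  · refine (ae_restrict_iff' measurableSet_Ioi).2 (.of_forall fun x hx z hz => ?_)
    have hx0 : (0 : ℝ) < x := hx
    rw [norm_neg, norm_rpow_mul_exp _ _ hx0]
    have h1 : |(z - s).re| < s.re / 2 :=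
      (Complex.abs_re_le_norm _).trans_lt (mem_ball_iff_norm.1 hz)
    rw [Complex.sub_re] at h1
    have h2 : s.re / 2 ≤ z.re := by
      have := (abs_lt.1 h1).1
      linarith
    gcongr
  · refine (ae_restrict_iff' measurableSet_Ioi).2 (.of_forall fun x hx z _ => ?_)
    have hx0 : (0 : ℝ) < x := hx
    have h : HasDerivAt (fun z : ℂ => Complex.exp (-(z * x)))
        (Complex.exp (-(z * x)) * (-(1 * x))) z :=
      (((hasDerivAt_id z).mul_const (x : ℂ)).neg).cexp
    refine (h.const_mul (((x ^ (α - 1) : ℝ) : ℂ))).congr_deriv ?_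
    rw [show α + 1 - 1 = α - 1 + 1 by ring, Real.rpow_add hx0, Real.rpow_one]
    push_cast
    ring

/-- `I(s) = ∫ x^(α-1) e^(-sx) dx` satisfies `I' = -(α / s) I`, so `s^α I(s)` is constant on the
right half-plane. -/
theorem integral_rpow_mul_exp (α : ℝ) (hα : 0 < α) {s : ℂ} (hs : 0 < s.re) :
    ∫ x in Ioi (0 : ℝ), ((x ^ (α - 1) : ℝ) : ℂ) * Complex.exp (-(s * x)) =
      Real.Gamma α * s ^ (-(α : ℂ)) := by
  set I : ℝ → ℂ → ℂ := fun β s =>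
    ∫ x in Ioi (0 : ℝ), ((x ^ (β - 1) : ℝ) : ℂ) * Complex.exp (-(s * x)) with hI
  have hG : (Real.Gamma α : ℂ) ≠ 0 := by exact_mod_cast (Real.Gamma_pos_of_pos hα).ne'
  have hα0 : (α : ℂ) ≠ 0 := by exact_mod_cast hα.ne'
  have hne : ∀ z : ℂ, 0 < z.re → z ≠ 0 := by
    rintro z hz rfl
    simp at hz
  have hrec : ∀ z : ℂ, 0 < z.re → α * I α z = z * I (α + 1) z := by
    intro z hz
    have h1 := laplace_derivPlus (powerPos (α + 1) (by positivity)) z hz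
    rw [derivPlus_powerPos α hα, laplace_powerPos_eq_integral, laplace_powerPos_eq_integral,
      Real.Gamma_add_one hα.ne'] at h1
    change (Real.Gamma α : ℂ)⁻¹ * I α z = z * (_ * I (α + 1) z) at h1
    push_cast at h1
    field_simp at h1
    rw [mul_comm, h1]
  have hderiv : ∀ z : ℂ, 0 < z.re → HasDerivAt (fun z => z ^ (α : ℂ) * I α z) 0 z := by
    intro z hz
    have h1 : HasDerivAt (fun z : ℂ => z ^ (α : ℂ)) (α * z ^ ((α : ℂ) - 1) * 1) z :=
      (hasDerivAt_id z).cpow_const (Or.inl hz)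
    refine (h1.mul (hasDerivAt_integral_rpow_mul_exp α hα hz)).congr_deriv ?_
    change α * z ^ ((α : ℂ) - 1) * 1 * I α z + z ^ (α : ℂ) * -I (α + 1) z = 0
    rw [mul_one, mul_right_comm, hrec z hz, Complex.cpow_sub _ _ (hne z hz), Complex.cpow_one]
    have := hne z hz
    field_simp
    ring
  have hopen : IsOpen {z : ℂ | 0 < z.re} := isOpen_lt continuous_const Complex.continuous_re
  have hconst : s ^ (α : ℂ) * I α s = (1 : ℂ) ^ (α : ℂ) * I α 1 :=
    hopen.is_const_of_deriv_eq_zero (f := fun z => z ^ (α : ℂ) * I α z)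
      (convex_halfSpace_re_gt 0).isPreconnected
      (fun z hz => (hderiv z hz).differentiableAt.differentiableWithinAt)
      (fun z hz => (hderiv z hz).deriv) hs (show 0 < (1 : ℂ).re by simp)
  have h1 : I α 1 = Real.Gamma α := by
    rw [Real.Gamma_eq_integral hα, ← integral_complex_ofReal]
    refine integral_congr_ae (.of_forall fun x => ?_)
    push_cast
    rw [one_mul, mul_comm]
  rw [Complex.one_cpow, one_mul, h1] at hconst
  change I α s = _
  rw [← hconst, Complex.cpow_neg, mul_right_comm, mul_inv_cancel₀, one_mul]
  exact fun h => hne s hs ((Complex.cpow_eq_zero_iff _ _).1 h).1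

theorem laplace_powerPos (α : ℝ) (hα : 0 < α) (s : ℂ) (hs : 0 < s.re) :
    laplace (powerPos α hα) s hs = s ^ (-(α : ℂ)) := by
  have hG : (Real.Gamma α : ℂ) ≠ 0 := by exact_mod_cast (Real.Gamma_pos_of_pos hα).ne'
  rw [laplace_powerPos_eq_integral, integral_rpow_mul_exp α hα hs, inv_mul_cancel_left₀ hG]

theorem laplace_power (α : ℝ) (s : ℂ) (hs : 0 < s.re) :
    laplace (power α) s hs = s ^ (-(α : ℂ)) := by
  have hs0 : s ≠ 0 := by
    rintro rfl
    simp at hs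
  have hit : ∀ (n : ℕ) (y : TemperedPlus),
      laplace (derivPlus^[n] y) s hs = s ^ n * laplace y s hs := by
    intro n y
    induction n with
    | zero => simp
    | succ n ih => rw [Function.iterate_succ_apply', laplace_derivPlus, ih, pow_succ']; ring
  obtain ⟨N, hN⟩ := exists_nat_gt (-α)
  rw [power_eq_iterate α N (by linarith), hit, laplace_powerPos, ← Complex.cpow_natCast,
    ← Complex.cpow_add _ _ hs0]
  congr 1
  push_cast
  ring

/-! ### The distributed order derivative -/

/-- The kernel `∫ φ(γ) f_(-γ) dγ ∈ S'_+`, that is `ψ ↦ ⟨φ(γ), ⟨f_(-γ), ψ⟩⟩`. -/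
noncomputable def orderKernel (φ : CompactDistribution) : TemperedPlus :=
  ⟨toDual.symm (φ.comp powerFamily), fun ψ hψ => by
    have h : powerFamily ψ = 0 := Subtype.ext (funext fun γ => (power (-γ)).2 ψ hψ)
    change φ (powerFamily ψ) = 0
    rw [h, map_zero]⟩

theorem laplace_orderKernel (φ : CompactDistribution) (s : ℂ) (hs : 0 < s.re) :
    laplace (orderKernel φ) s hs = φ (powFun s hs) := by
  refine congrArg φ (Subtype.ext (funext fun γ => ?_))
  refine (laplace_power (-γ) s hs).trans ?_
  rw [Complex.ofReal_neg, neg_neg]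
  rfl

/-- `orderKernel φ * y` is the distributed order derivative of `y`, by definition of `conv`. -/
theorem conv_orderKernel_apply (φ : CompactDistribution) (y : TemperedPlus) (ψ : 𝓢(ℝ, ℂ)) :
    (conv (orderKernel φ) y).1 ψ =
      φ ⟨fun γ : ℝ => (fracDeriv γ y).1 ψ, contDiff_power_apply (convTest (toDual y.1) ψ)⟩ := rfl

/-- Convolution `y ↦ y * g` with a fixed `g ∈ S'_+`. With the variable `y` on the left it is the
transpose of `convTest g`. -/
noncomputable def convRight (g : TemperedPlus) : TemperedPlus →ₗ[ℂ] TemperedPlus where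
  toFun y := conv y g
  map_add' _ _ := rfl
  map_smul' _ _ := rfl

theorem continuous_convRight (g : TemperedPlus) : Continuous (convRight g) := by
  refine continuous_induced_rng.2 ?_
  exact (PointwiseConvergenceCLM.precomp ℂ (convTest (toDual g.1))).continuous.comp
    continuous_subtype_val

theorem continuous_strong_convRight (g : TemperedPlus) :
    Continuous[strongTopology, strongTopology] (convRight g) := by
  have h : Continuous[strongTopology, inferInstance] fun y : TemperedPlus =>
      ContinuousLinearMap.precomp ℂ (convTest (toDual g.1)) (toDual y.1) :=
    @Continuous.comp _ _ _ strongTopology _ _ (fun y : TemperedPlus => toDual y.1)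
      (ContinuousLinearMap.precomp ℂ (convTest (toDual g.1)))
      (ContinuousLinearMap.continuous _) continuous_induced_dom
  exact (continuous_induced_rng (t₁ := strongTopology)).2 h

theorem regular_powFun {u : ℝ → ℂ} {c d : ℝ} (hcd : c ≤ d) (hu : ContinuousOn u (Icc c d))
    (hu0 : ∀ γ, γ ∉ Icc c d → u γ = 0) (s : ℂ) (hs : 0 < s.re) :
    regular u c d hu hu0 (powFun s hs) = ∫ γ in c..d, u γ * s ^ (γ : ℂ) := by
  rw [intervalIntegral.integral_of_le hcd, ← integral_Icc_eq_integral_Ioc,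
    setIntegral_eq_integral_of_forall_compl_eq_zero fun γ hγ => by rw [hu0 γ hγ, zero_mul]]
  rfl

end DistOrder

open DistOrder
theorem proposition2 (φ : CompactDistribution) :
    ∃ T : TemperedPlus →ₗ[ℂ] TemperedPlus,
      (∀ y : TemperedPlus, IsDistributedOrderDeriv φ y (T y)) ∧
      Continuous T ∧
      Continuous[strongTopology, strongTopology] T ∧
      (∀ (y : TemperedPlus) (s : ℂ) (hs : 0 < s.re),
        laplace (T y) s hs = laplace y s hs * φ (powFun s hs)) ∧
      (∀ (u : ℝ → ℂ) (c d : ℝ) (_ : c ≤ d) (hu : ContinuousOn u (Set.Icc c d))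
        (hu0 : ∀ γ, γ ∉ Set.Icc c d → u γ = 0), φ = regular u c d hu hu0 →
        ∀ (y : TemperedPlus) (s : ℂ) (hs : 0 < s.re),
          laplace (T y) s hs = laplace y s hs * ∫ γ in c..d, u γ * s ^ (γ : ℂ)) := by
  have hL : ∀ (y : TemperedPlus) (s : ℂ) (hs : 0 < s.re),
      laplace (convRight (orderKernel φ) y) s hs = laplace y s hs * φ (powFun s hs) := by
    intro y s hs
    rw [← laplace_orderKernel]
    exact laplace_conv y (orderKernel φ) s hs
  refine ⟨convRight (orderKernel φ), fun y ψ => ⟨contDiff_power_apply _, ?_⟩,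
    continuous_convRight _, continuous_strong_convRight _, hL, ?_⟩
  · change (conv y (orderKernel φ)).1 ψ = _
    rw [conv_comm]
    exact conv_orderKernel_apply φ y ψ
  · intro u c d hcd hu hu0 hφ y s hs
    rw [hL, hφ, regular_powFun hcd]
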